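/- Manifolds are smooth ($C^\infty$), finite dimensional, without boundary, Hausdorff and second countable; all maps and actions are smooth. Let $G$ be a Lie group, and let $\lambda: G\times S\to S$ and $\mu: G\times S'\to S'$ be smooth left actions on manifolds $S,S'$ that are effective, i.e. the induced homomorphisms $G\to\mathrm{Diff}\,S$ and $G\to\mathrm{Diff}\,S'$ are injective. A $G$-cocycle on a manifold $M$ is an open cover $(U_\alpha)$ of $M$ with smooth maps $g_{\alpha\beta}:U_\alpha\cap U_\beta\to G$ such that $g_{\alpha\beta}g_{\beta\gamma}=g_{\alpha\gamma}$ on triple overlaps and $g_{\alpha\alpha}=e$. A map of cocycles $(M,U_\alpha,g_{\alpha\beta})\to(M',U'_\alpha,g'_{\alpha\beta})$ is a smooth map $h:M\to M'$ with smooth maps $h_{\alpha\beta}:U_\beta\cap h^{-1}(U'_\alpha)\to G$ such that $h_{\alpha\beta}\,g_{\beta\gamma}=h_{\alpha\gamma}$ and $(g'_{\alpha\beta}\circ h)\,h_{\beta\gamma}=h_{\alpha\gamma}$ wherever both sides are defined; composition is $(i\circ h)_{\alpha\gamma}(m)=i_{\alpha\beta}(h(m))\,h_{\beta\gamma}(m)$.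 This gives the category $CC^G$. A fibre bundle with fibre $S$ is a smooth map $\pi:F\to M$ of manifolds that has, near every point of $M$, local trivialisations, i.e. fibre-respecting diffeomorphisms $\pi^{-1}(U)\cong U\times S$ with $U$ open; a map $\pi\to\pi'$ of fibre bundles is a pair of smooth maps $k:F\to F'$, $k_M:M\to M'$ with $\pi'\circ k=k_M\circ\pi$. A coordinate $(G,\lambda)$-bundle structure on $\pi$ is a $G$-cocycle $(U_\alpha,g_{\alpha\beta})$ on $M$ with local trivialisations $\psi_\alpha$ over $U_\alpha$ such that $\psi_\alpha\circ\psi_\beta^{-1}(m,s)=(m,\lambda(g_{\alpha\beta}(m),s))$. A map of coordinate $(G,\lambda)$-bundles is a map $(h,h_{\alpha\beta})$ of cocycles with a map $(k,k_M)$ of fibre bundles such that $k_M=h$ and $\psi'_\alpha\circ k\circ\psi_\beta^{-1}(m,s)=(h(m),\lambda(h_{\alpha\beta}(m),s))$. This gives the category $CFB^\lambda$. Let $CU^\lambda: CFB^\lambda\to CC^G$ be the forgetful functor, and let $CB^\lambda: CC^G\to CFB^\lambda$ be the functor that glues the products $U_\alpha\times S$ along the $\lambda(g_{\alpha\beta})$,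 and the maps $(m,s)\mapsto (h(m),\lambda(h_{\alpha\beta}(m),s))$. Two coordinate structures $(U_\alpha,\psi_\alpha,g_{\alpha\beta})$ and $(\tilde U_\alpha,\tilde\psi_\alpha,\tilde g_{\alpha\beta})$ on the same fibre bundle are strictly equivalent if there are smooth $t_{\alpha\beta}:U_\beta\cap\tilde U_\alpha\to G$ with $\tilde\psi_\alpha\circ\psi_\beta^{-1}(m,s)=(m,\lambda(t_{\alpha\beta}(m),s))$. A $(G,\lambda)$-fibre bundle is a fibre bundle with a strict equivalence class of coordinate structures. Arrows of $(G,\lambda)$-fibre bundles are equivalence classes of arrows between representatives in $CFB^\lambda$, two being equivalent if they have the same underlying map of fibre bundles. This gives the category $FB^\lambda$, and a quotient functor $Q^\lambda:CFB^\lambda\to FB^\lambda$. Let $\Sigma^\lambda: FB^\lambda\to CFB^\lambda$ be the functor that sends a $(G,\lambda)$-fibre bundle to its maximal coordinate structure (the union of all representatives, with the transition functions that this determines), and an arrow to its unique lift to the maximal structures. Put $C^{\lambda\mu}:=Q^\mu\circ CB^\mu\circ CU^\lambda\circ\Sigma^\lambda: FB^\lambda\to FB^\mu$, and define $C^{\mu\lambda}$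 in the same way with $\lambda$ and $\mu$ interchanged. Theorem. The functors $C^{\mu\lambda}: FB^\mu\to FB^\lambda$ and $C^{\lambda\mu}: FB^\lambda\to FB^\mu$ are mutually inverse equivalences of categories, $FB^\mu\simeq FB^\lambda$. In particular, if $L$ denotes the action of $G$ on itself by left multiplication and $PB^G:=FB^L$ the category of principal $G$-bundles, then $C^{L\lambda}$ and $C^{\lambda L}$ are mutually inverse equivalences $PB^G\simeq FB^\lambda$. -/

import Mathlib

open CategoryTheory
open scoped Manifold ContDiff

universe u

noncomputable section

/-! ### Manifolds and fibre bundles -/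

/-- A smooth manifold: finite dimensional, without boundary, Hausdorff, second countable. -/
structure SmoothMfd where
  carrier : Type u
  model : Type u
  [normedAddCommGroup : NormedAddCommGroup model]
  [normedSpace : NormedSpace ℝ model]
  [finiteDimensional : FiniteDimensional ℝ model]
  [topologicalSpace : TopologicalSpace carrier]
  [t2Space : T2Space carrier]
  [secondCountableTopology : SecondCountableTopology carrier]
  [chartedSpace : ChartedSpace model carrier]
  [isManifold : IsManifold 𝓘(ℝ, model) ∞ carrier]

attribute [instance] SmoothMfd.normedAddCommGroup SmoothMfd.normedSpace
  SmoothMfd.finiteDimensional SmoothMfd.topologicalSpace SmoothMfd.t2Space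
  SmoothMfd.secondCountableTopology SmoothMfd.chartedSpace SmoothMfd.isManifold

instance : CoeSort SmoothMfd.{u} (Type u) := ⟨SmoothMfd.carrier⟩

/-- Smoothness of a map of manifolds. -/
def Smooth {M N : SmoothMfd.{u}} (f : M → N) : Prop :=
  ContMDiff 𝓘(ℝ, M.model) 𝓘(ℝ, N.model) ∞ f

/-- Smoothness of a map of manifolds on a subset. It is used for open subsets only. -/
def SmoothOn {M N : SmoothMfd.{u}} (f : M → N) (s : Set M) : Prop :=
  ContMDiffOn 𝓘(ℝ, M.model) 𝓘(ℝ, N.model) ∞ f s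

/-- A local trivialisation `π⁻¹(U) ≅ U × S` over an open set `U` is smooth if it is a
diffeomorphism. -/
def IsSmoothTriv {S F M : SmoothMfd.{u}} {proj : F → M} (e : Bundle.Trivialization S proj) : Prop :=
  ContMDiffOn 𝓘(ℝ, F.model) (𝓘(ℝ, M.model).prod 𝓘(ℝ, S.model)) ∞ e e.source ∧
  ContMDiffOn (𝓘(ℝ, M.model).prod 𝓘(ℝ, S.model)) 𝓘(ℝ, F.model) ∞
    e.toOpenPartialHomeomorph.symm e.target

/-- Fibre bundles with standard fibre `S`. -/
structure FibreBundle (S : SmoothMfd.{u}) where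
  total : SmoothMfd.{u}
  base : SmoothMfd.{u}
  proj : total → base
  smooth_proj : Smooth proj
  exists_triv : ∀ m : base, ∃ e : Bundle.Trivialization S proj, m ∈ e.baseSet ∧ IsSmoothTriv e

/-- Maps of fibre bundles. -/
@[ext]
structure BundleMap {S : SmoothMfd.{u}} (X Y : FibreBundle S) where
  total : X.total → Y.total
  base : X.base → Y.base
  smooth_total : Smooth total
  smooth_base : Smooth base
  comm : ∀ f, Y.proj (total f) = base (X.proj f)

namespace BundleMap

variable {S : SmoothMfd.{u}}

/-- The identity map of a fibre bundle. -/
def id (X : FibreBundle S) : BundleMap X X where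
  total := fun f => f
  base := fun m => m
  smooth_total := contMDiff_id
  smooth_base := contMDiff_id
  comm _ := rfl

/-- Composition of maps of fibre bundles (in diagrammatic order). -/
def comp {X Y Z : FibreBundle S} (k : BundleMap X Y) (l : BundleMap Y Z) : BundleMap X Z where
  total := fun f => l.total (k.total f)
  base := fun m => l.base (k.base m)
  smooth_total := ContMDiff.comp l.smooth_total k.smooth_total
  smooth_base := ContMDiff.comp l.smooth_base k.smooth_base
  comm f := by rw [l.comm, k.comm]

end BundleMap

/-! ### Gluing fibre bundles from cocycles -/

section Gluing

theorem smooth_proj_of_triv {S F M : SmoothMfd.{u}} {proj : F → M}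
    (h : ∀ m, ∃ e : Bundle.Trivialization S proj, m ∈ e.baseSet ∧ IsSmoothTriv e) :
    Smooth proj := by
  intro t
  obtain ⟨e, he, hs⟩ := h (proj t)
  have ht : t ∈ e.source := e.mem_source.2 he
  have h1 := (hs.1 t ht).contMDiffAt (e.open_source.mem_nhds ht)
  refine (ContMDiffAt.comp t contMDiffAt_fst h1).congr_of_eventuallyEq ?_
  filter_upwards [e.open_source.mem_nhds ht] with z hz
  exact (e.coe_fst hz).symm

open Bundle

variable {S M : SmoothMfd.{u}} {T : Type u} [TopologicalSpace T] {proj : T → M} {ι : Type u}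

theorem t2Space_of_trivializations (hproj : Continuous proj) (e : ι → Trivialization S proj)
    (he : ∀ m, ∃ i, m ∈ (e i).baseSet) : T2Space T := by
  refine ⟨fun x y hxy => ?_⟩
  by_cases h : proj x = proj y
  · obtain ⟨i, hi⟩ := he (proj x)
    have hx : x ∈ (e i).source := (e i).mem_source.2 hi
    have hy : y ∈ (e i).source := (e i).mem_source.2 (h ▸ hi)
    have hne : e i x ≠ e i y := fun hh => hxy ((e i).injOn hx hy hh)
    obtain ⟨u, v, hu, hv, hxu, hyv, huv⟩ := t2_separation hne
    refine ⟨(e i).source ∩ e i ⁻¹' u, (e i).source ∩ e i ⁻¹' v,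
      (e i).toOpenPartialHomeomorph.isOpen_inter_preimage hu,
      (e i).toOpenPartialHomeomorph.isOpen_inter_preimage hv, ⟨hx, hxu⟩, ⟨hy, hyv⟩, ?_⟩
    refine Set.disjoint_left.2 fun z hz hz' => Set.disjoint_left.1 huv hz.2 hz'.2
  · obtain ⟨u, v, hu, hv, hxu, hyv, huv⟩ := t2_separation h
    exact ⟨proj ⁻¹' u, proj ⁻¹' v, hu.preimage hproj, hv.preimage hproj, hxu, hyv,
      huv.preimage proj⟩

theorem secondCountable_of_trivializations
    (e : ι → Trivialization S proj) (he : ∀ m, ∃ i, m ∈ (e i).baseSet) :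
    SecondCountableTopology T := by
  obtain ⟨c, hc, hcU⟩ := TopologicalSpace.isOpen_iUnion_countable (fun i => (e i).baseSet)
    (fun i => (e i).open_baseSet)
  have : Countable c := hc
  have : ∀ i : c, SecondCountableTopology (e i).source := fun i =>
    (e i).toOpenPartialHomeomorph.secondCountableTopology_source
  refine TopologicalSpace.secondCountableTopology_of_countable_cover
    (U := fun i : c => (e i).source) (fun i => (e i).open_source) ?_
  refine Set.eq_univ_of_forall fun x => ?_
  obtain ⟨i, hi⟩ := he (proj x)
  have hx : proj x ∈ ⋃ i ∈ c, (e i).baseSet := by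
    rw [hcU]; exact Set.mem_iUnion.2 ⟨i, hi⟩
  obtain ⟨j, hj, hxj⟩ := Set.mem_iUnion₂.1 hx
  exact Set.mem_iUnion.2 ⟨⟨j, hj⟩, (e j).mem_source.2 hxj⟩

/-- The charted space structure for which the charts are the composites of local trivialisations
with charts of `M × S`. -/
@[reducible]
def gluedCharts (e : ι → Trivialization S proj) (idx : T → ι)
    (hidx : ∀ t, proj t ∈ (e (idx t)).baseSet) : ChartedSpace (M.model × S.model) T where
  atlas := {φ | ∃ i, ∃ c ∈ atlas (ModelProd M.model S.model) (M × S),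
    φ = (e i).toOpenPartialHomeomorph.trans c}
  chartAt t := (e (idx t)).toOpenPartialHomeomorph.trans
    (chartAt (ModelProd M.model S.model) (e (idx t) t))
  mem_chart_source t := by
    rw [OpenPartialHomeomorph.trans_source]
    exact ⟨(e (idx t)).mem_source.2 (hidx t), mem_chart_source (ModelProd M.model S.model) (e (idx t) t)⟩
  chart_mem_atlas t := ⟨idx t, _, chart_mem_atlas _ _, rfl⟩

theorem smooth_chart (c : OpenPartialHomeomorph (M × S) (M.model × S.model))
    (hc : c ∈ atlas (ModelProd M.model S.model) (M × S)) :
    ContMDiffOn (𝓘(ℝ, M.model).prod 𝓘(ℝ, S.model)) 𝓘(ℝ, M.model × S.model) ∞ c c.source ∧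
    ContMDiffOn 𝓘(ℝ, M.model × S.model) (𝓘(ℝ, M.model).prod 𝓘(ℝ, S.model)) ∞ c.symm c.target := by
  have h := IsManifold.subset_maximalAtlas (I := 𝓘(ℝ, M.model).prod 𝓘(ℝ, S.model)) (n := ∞) hc
  have h1 := contMDiffOn_of_mem_maximalAtlas h
  have h2 := contMDiffOn_symm_of_mem_maximalAtlas h
  rw [modelWithCornersSelf_prod]
  exact ⟨h1, h2⟩

theorem gluedCharts_isManifold (e : ι → Trivialization S proj) (idx : T → ι)
    (hidx : ∀ t, proj t ∈ (e (idx t)).baseSet)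
    (htrans : ∀ i j, ContMDiffOn (𝓘(ℝ, M.model).prod 𝓘(ℝ, S.model))
      (𝓘(ℝ, M.model).prod 𝓘(ℝ, S.model)) ∞
      (fun p => e j ((e i).toOpenPartialHomeomorph.symm p))
      {p | p.1 ∈ (e i).baseSet ∧ p.1 ∈ (e j).baseSet}) :
    @IsManifold ℝ _ (M.model × S.model) _ _ (M.model × S.model) _ 𝓘(ℝ, M.model × S.model) ∞ T _
      (gluedCharts e idx hidx) := by
  let _ := gluedCharts e idx hidx
  refine isManifold_of_contDiffOn _ _ _ ?_
  rintro _ _ ⟨i, (c : OpenPartialHomeomorph (M × S) (M.model × S.model)), hc, rfl⟩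
    ⟨j, (d : OpenPartialHomeomorph (M × S) (M.model × S.model)), hd, rfl⟩
  have key : ContMDiffOn 𝓘(ℝ, M.model × S.model) 𝓘(ℝ, M.model × S.model) ∞
      (fun x => d (e j ((e i).toOpenPartialHomeomorph.symm (c.symm x))))
      (((e i).toOpenPartialHomeomorph.trans c).symm.trans
        ((e j).toOpenPartialHomeomorph.trans d)).source := by
    intro x hx
    simp only [OpenPartialHomeomorph.trans_source, OpenPartialHomeomorph.symm_source,
      Set.mem_inter_iff, Set.mem_preimage,
      OpenPartialHomeomorph.trans_symm_eq_symm_trans_symm, OpenPartialHomeomorph.coe_trans,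
      Function.comp_apply] at hx
    obtain ⟨⟨hx1, hx2⟩, hx3, hx4⟩ := hx
    have a2 : (c.symm x).1 ∈ (e i).baseSet := (e i).mem_target.1 hx2
    have a3 : (c.symm x).1 ∈ (e j).baseSet := by
      rw [← (e i).proj_symm_apply hx2]; exact (e j).mem_source.1 hx3
    have b1 := ((smooth_chart c hc).2 x hx1).contMDiffAt (c.open_target.mem_nhds hx1)
    have hopen : IsOpen {p : M × S | p.1 ∈ (e i).baseSet ∧ p.1 ∈ (e j).baseSet} :=
      (((e i).open_baseSet.inter (e j).open_baseSet).preimage continuous_fst)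
    have b2 := (htrans i j (c.symm x) ⟨a2, a3⟩).contMDiffAt (hopen.mem_nhds ⟨a2, a3⟩)
    have b3 := ((smooth_chart d hd).1 _ hx4).contMDiffAt (d.open_source.mem_nhds hx4)
    exact (ContMDiffAt.comp x b3 (ContMDiffAt.comp x b2 b1)).contMDiffWithinAt
  have key2 := contMDiffOn_iff_contDiffOn.1 key
  refine key2.congr_mono (fun x _ => rfl) ?_
  rintro x ⟨hx, -⟩
  exact hx

/-- The manifold structure on a space with smoothly compatible local trivialisations. -/
@[reducible]
def gluedMfd (hproj : Continuous proj) (e : ι → Trivialization S proj) (idx : T → ι)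
    (hidx : ∀ t, proj t ∈ (e (idx t)).baseSet) (he : ∀ m, ∃ i, m ∈ (e i).baseSet)
    (htrans : ∀ i j, ContMDiffOn (𝓘(ℝ, M.model).prod 𝓘(ℝ, S.model))
      (𝓘(ℝ, M.model).prod 𝓘(ℝ, S.model)) ∞
      (fun p => e j ((e i).toOpenPartialHomeomorph.symm p))
      {p | p.1 ∈ (e i).baseSet ∧ p.1 ∈ (e j).baseSet}) : SmoothMfd.{u} where
  carrier := T
  model := M.model × S.model
  t2Space := t2Space_of_trivializations hproj e he
  secondCountableTopology := secondCountable_of_trivializations e he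
  chartedSpace := gluedCharts e idx hidx
  isManifold := gluedCharts_isManifold e idx hidx htrans

theorem gluedMfd_isSmoothTriv (hproj : Continuous proj) (e : ι → Trivialization S proj)
    (idx : T → ι) (hidx : ∀ t, proj t ∈ (e (idx t)).baseSet)
    (he : ∀ m, ∃ i, m ∈ (e i).baseSet)
    (htrans : ∀ i j, ContMDiffOn (𝓘(ℝ, M.model).prod 𝓘(ℝ, S.model))
      (𝓘(ℝ, M.model).prod 𝓘(ℝ, S.model)) ∞
      (fun p => e j ((e i).toOpenPartialHomeomorph.symm p))
      {p | p.1 ∈ (e i).baseSet ∧ p.1 ∈ (e j).baseSet}) (i : ι) :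
    IsSmoothTriv (F := gluedMfd hproj e idx hidx he htrans) (e i) := by
  let _ := gluedCharts e idx hidx
  have _ := gluedCharts_isManifold e idx hidx htrans
  have hat : ∀ c ∈ atlas (ModelProd M.model S.model) (M × S),
      (e i).toOpenPartialHomeomorph.trans c ∈ atlas (M.model × S.model) T :=
    fun c hc => ⟨i, c, hc, rfl⟩
  constructor
  · intro t ht
    let c : OpenPartialHomeomorph (M × S) (M.model × S.model) :=
      chartAt (ModelProd M.model S.model) (e i t)
    have hc : c ∈ atlas (ModelProd M.model S.model) (M × S) := chart_mem_atlas _ _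
    have hm := IsManifold.subset_maximalAtlas (I := 𝓘(ℝ, M.model × S.model)) (n := ∞) (hat c hc)
    have h1 := contMDiffOn_of_mem_maximalAtlas hm
    have hts : t ∈ ((e i).toOpenPartialHomeomorph.trans c).source := by
      rw [OpenPartialHomeomorph.trans_source]
      exact ⟨ht, mem_chart_source (ModelProd M.model S.model) (e i t)⟩
    have h2 := (h1 t hts).contMDiffAt
      (((e i).toOpenPartialHomeomorph.trans c).open_source.mem_nhds hts)
    have hct : c (e i t) ∈ c.target := c.map_source (mem_chart_source (ModelProd M.model S.model) (e i t))
    have h3 := ((smooth_chart c hc).2 _ hct).contMDiffAt (c.open_target.mem_nhds hct)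
    have h4 := ContMDiffAt.comp t h3 h2
    refine (h4.congr_of_eventuallyEq ?_).contMDiffWithinAt
    filter_upwards [((e i).toOpenPartialHomeomorph.trans c).open_source.mem_nhds hts] with z hz
    rw [OpenPartialHomeomorph.trans_source] at hz
    exact (c.left_inv hz.2).symm
  · intro p hp
    let c : OpenPartialHomeomorph (M × S) (M.model × S.model) :=
      chartAt (ModelProd M.model S.model) p
    have hc : c ∈ atlas (ModelProd M.model S.model) (M × S) := chart_mem_atlas _ _
    have hm := IsManifold.subset_maximalAtlas (I := 𝓘(ℝ, M.model × S.model)) (n := ∞) (hat c hc)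
    have h1 := contMDiffOn_symm_of_mem_maximalAtlas hm
    have hps : p ∈ c.source := mem_chart_source (ModelProd M.model S.model) p
    have hts : c p ∈ ((e i).toOpenPartialHomeomorph.trans c).target := by
      rw [OpenPartialHomeomorph.trans_target]
      refine ⟨c.map_source hps, ?_⟩
      change c.symm (c p) ∈ (e i).target
      rwa [c.left_inv hps]
    have h2 := (h1 _ hts).contMDiffAt
      (((e i).toOpenPartialHomeomorph.trans c).open_target.mem_nhds hts)
    have h3 := ((smooth_chart c hc).1 p hps).contMDiffAt (c.open_source.mem_nhds hps)
    have h4 := ContMDiffAt.comp p h2 h3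
    refine (h4.congr_of_eventuallyEq ?_).contMDiffWithinAt
    filter_upwards [c.open_source.mem_nhds hps] with z hz
    change _ = (e i).toOpenPartialHomeomorph.symm (c.symm (c z))
    rw [c.left_inv hz]

end Gluing

/-! ### Cocycles of transition functions -/

section Cocycles

variable (G : SmoothMfd.{u}) [Group G]

/-- A `G`-cocycle of transition functions on `M`. The function `g i j` lives on `U i ∩ U j`; it is
encoded by its extension to `M` with the value `1` elsewhere, so that equality of the encodings is
equality of the functions on `U i ∩ U j`. -/
structure GCocycle (M : SmoothMfd.{u}) where
  ι : Type u
  U : ι → TopologicalSpace.Opens M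
  cover : ∀ m, ∃ i, m ∈ U i
  g : ι → ι → M → G
  smooth_g : ∀ i j, SmoothOn (g i j) {m | m ∈ U i ∧ m ∈ U j}
  g_off : ∀ i j m, ¬ (m ∈ U i ∧ m ∈ U j) → g i j m = 1
  g_mul : ∀ i j k m, m ∈ U i → m ∈ U j → m ∈ U k → g i j m * g j k m = g i k m
  g_self : ∀ i m, m ∈ U i → g i i m = 1

/-- Objects of the category of `G`-cocycles: manifolds with a `G`-cocycle. -/
structure CC where
  base : SmoothMfd.{u}
  cocycle : GCocycle G base

variable {G}

/-- Maps of cocycles. The function `h a b` lives on `U b ∩ base⁻¹ (U' a)` and is encoded by its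
extension with the value `1` elsewhere. -/
@[ext]
structure CC.Hom (C D : CC G) where
  base : C.base → D.base
  smooth_base : Smooth base
  h : D.cocycle.ι → C.cocycle.ι → C.base → G
  smooth_h : ∀ a b, SmoothOn (h a b) {m | m ∈ C.cocycle.U b ∧ base m ∈ D.cocycle.U a}
  h_off : ∀ a b m, ¬ (m ∈ C.cocycle.U b ∧ base m ∈ D.cocycle.U a) → h a b m = 1
  h_mul_g : ∀ a b c m, m ∈ C.cocycle.U c → m ∈ C.cocycle.U b → base m ∈ D.cocycle.U a →
    h a b m * C.cocycle.g b c m = h a c m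
  g_mul_h : ∀ a b c m, m ∈ C.cocycle.U c → base m ∈ D.cocycle.U b → base m ∈ D.cocycle.U a →
    D.cocycle.g a b (base m) * h b c m = h a c m

namespace CC

/-- The identity map of a cocycle. -/
def Hom.id (C : CC G) : Hom C C where
  base := fun m => m
  smooth_base := contMDiff_id
  h := C.cocycle.g
  smooth_h a b := by
    simpa only [and_comm] using C.cocycle.smooth_g a b
  h_off a b m hm := C.cocycle.g_off a b m (fun h => hm h.symm)
  h_mul_g a b c m hc hb ha := C.cocycle.g_mul a b c m ha hb hc
  g_mul_h a b c m hc hb ha := C.cocycle.g_mul a b c m ha hb hc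

open Classical in
/-- The group valued functions of a composite: `h a c m = l a b (k m) * k b c m`, for any `b` with
`k m ∈ U' b`. -/
def compFun {C D E : CC G} (k : Hom C D) (l : Hom D E) (a : E.cocycle.ι) (c : C.cocycle.ι)
    (m : C.base) : G :=
  if m ∈ C.cocycle.U c ∧ l.base (k.base m) ∈ E.cocycle.U a then
    l.h a (D.cocycle.cover (k.base m)).choose (k.base m) *
      k.h (D.cocycle.cover (k.base m)).choose c m
  else 1

theorem compFun_eq {C D E : CC G} (k : Hom C D) (l : Hom D E) (a : E.cocycle.ι)
    (b : D.cocycle.ι) (c : C.cocycle.ι) (m : C.base) (hc : m ∈ C.cocycle.U c)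
    (hb : k.base m ∈ D.cocycle.U b) (ha : l.base (k.base m) ∈ E.cocycle.U a) :
    compFun k l a c m = l.h a b (k.base m) * k.h b c m := by
  have hb' := (D.cocycle.cover (k.base m)).choose_spec
  rw [compFun, if_pos ⟨hc, ha⟩, ← k.g_mul_h _ b c m hc hb hb', ← mul_assoc,
    l.h_mul_g a _ b _ hb hb' ha]

theorem Hom.ext_of {C D : CC G} {k l : Hom C D} (hbase : k.base = l.base)
    (hh : ∀ a b m, m ∈ C.cocycle.U b → k.base m ∈ D.cocycle.U a → k.h a b m = l.h a b m) :
    k = l := by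
  refine Hom.ext hbase ?_
  funext a b m
  by_cases hm : m ∈ C.cocycle.U b ∧ k.base m ∈ D.cocycle.U a
  · exact hh a b m hm.1 hm.2
  · rw [k.h_off a b m hm, l.h_off a b m (by rwa [← hbase])]

variable [LieGroup 𝓘(ℝ, G.model) ∞ G]

/-- Composition of maps of cocycles (in diagrammatic order). -/
def Hom.comp {C D E : CC G} (k : Hom C D) (l : Hom D E) : Hom C E where
  base := fun m => l.base (k.base m)
  smooth_base := ContMDiff.comp l.smooth_base k.smooth_base
  h := compFun k l
  smooth_h a c := by
    rintro m ⟨hc, ha⟩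
    obtain ⟨b, hb⟩ := D.cocycle.cover (k.base m)
    have hk : Continuous k.base := k.smooth_base.continuous
    have hl : Continuous l.base := l.smooth_base.continuous
    have hopen : IsOpen {x | x ∈ C.cocycle.U c ∧ k.base x ∈ D.cocycle.U b ∧
        l.base (k.base x) ∈ E.cocycle.U a} :=
      (C.cocycle.U c).isOpen.inter
        (((D.cocycle.U b).isOpen.preimage hk).inter
          ((E.cocycle.U a).isOpen.preimage (hl.comp hk)))
    have h1 : ContMDiffOn 𝓘(ℝ, C.base.model) 𝓘(ℝ, G.model) ∞
        (fun x => l.h a b (k.base x) * k.h b c x) {x | x ∈ C.cocycle.U c ∧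
          k.base x ∈ D.cocycle.U b ∧ l.base (k.base x) ∈ E.cocycle.U a} := by
      apply ContMDiffOn.mul
      · exact ContMDiffOn.comp (l.smooth_h a b) k.smooth_base.contMDiffOn
          (fun x hx => ⟨hx.2.1, hx.2.2⟩)
      · exact ContMDiffOn.mono (k.smooth_h b c) (fun x hx => ⟨hx.1, hx.2.1⟩)
    have h2 := (h1.congr (f₁ := compFun k l a c)
      (fun x hx => compFun_eq k l a b c x hx.1 hx.2.1 hx.2.2)).contMDiffAt
        (hopen.mem_nhds ⟨hc, hb, ha⟩)
    exact h2.contMDiffWithinAt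
  h_off a b m hm := if_neg hm
  h_mul_g a b c m hc hb ha := by
    obtain ⟨d, hd⟩ := D.cocycle.cover (k.base m)
    rw [compFun_eq k l a d b m hb hd ha, compFun_eq k l a d c m hc hd ha, mul_assoc,
      k.h_mul_g d b c m hc hb hd]
  g_mul_h a b c m hc hb ha := by
    obtain ⟨d, hd⟩ := D.cocycle.cover (k.base m)
    rw [compFun_eq k l b d c m hc hd hb, compFun_eq k l a d c m hc hd ha, ← mul_assoc,
      l.g_mul_h a b d _ hd hb ha]

/-- The category of `G`-cocycles. -/
instance : Category (CC G) where
  Hom := Hom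
  id := Hom.id
  comp := Hom.comp
  id_comp {C D} k := by
    refine Hom.ext_of rfl fun a b m hb ha => ?_
    exact (compFun_eq (Hom.id C) k a b b m hb hb ha).trans (k.h_mul_g a b b m hb hb ha)
  comp_id {C D} k := by
    refine Hom.ext_of rfl fun a b m hb ha => ?_
    exact (compFun_eq k (Hom.id D) a a b m hb ha ha).trans (k.g_mul_h a a b m hb ha ha)
  assoc {A B C D} k l n := by
    refine Hom.ext_of rfl fun a b m hb ha => ?_
    obtain ⟨c, hc⟩ := B.cocycle.cover (k.base m)
    obtain ⟨d, hd⟩ := C.cocycle.cover (l.base (k.base m))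
    refine (compFun_eq (k.comp l) n a d b m hb hd ha).trans ?_
    refine Eq.trans ?_ (compFun_eq k (l.comp n) a c b m hb hc ha).symm
    change _ * compFun k l d b m = compFun l n a c (k.base m) * _
    rw [compFun_eq k l d c b m hb hc hd, compFun_eq l n a d c _ hc hd ha, mul_assoc]
    rfl

end CC

end Cocycles

/-! ### Coordinate bundles -/

section Coordinate

variable (G : SmoothMfd.{u}) [Group G] {S : SmoothMfd.{u}} [MulAction G S]

/-- In the local trivialisations `e` and `e'`, the bundle map `k` is given by
`(m, s) ↦ (k m, h m • s)`. -/
def HasLocalForm {X Y : FibreBundle S} (k : BundleMap X Y) (e : Bundle.Trivialization S X.proj)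
    (e' : Bundle.Trivialization S Y.proj) (h : X.base → G) : Prop :=
  ∀ m ∈ e.baseSet, k.base m ∈ e'.baseSet → ∀ s : S,
    e' (k.total (e.toOpenPartialHomeomorph.symm (m, s))) = (k.base m, h m • s)

/-- A coordinate `(G, λ)`-bundle structure on a fibre bundle: a `G`-cocycle and a fibre bundle atlas
over the same cover such that `ψ_i ∘ ψ_j⁻¹ (m, s) = (m, g_ij(m) • s)`. -/
structure CoordStructure (X : FibreBundle S) where
  cocycle : GCocycle G X.base
  triv : cocycle.ι → Bundle.Trivialization S X.proj
  smooth_triv : ∀ i, IsSmoothTriv (triv i)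
  baseSet_triv : ∀ i, (triv i).baseSet = cocycle.U i
  transition : ∀ i j m, m ∈ cocycle.U i → m ∈ cocycle.U j → ∀ s : S,
    triv i ((triv j).toOpenPartialHomeomorph.symm (m, s)) = (m, cocycle.g i j m • s)

variable (S) in
/-- Objects of the category of coordinate `(G, λ)`-bundles. -/
structure CFB where
  bundle : FibreBundle S
  coord : CoordStructure G bundle

variable {G}

/-- The underlying cocycle of a coordinate bundle. -/
def CFB.toCC (X : CFB G S) : CC G := ⟨X.bundle.base, X.coord.cocycle⟩

/-- Maps of coordinate bundles: a map of cocycles and a map of fibre bundles over the same map of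
base manifolds such that `ψ'_a ∘ k ∘ ψ_b⁻¹ (m, s) = (k m, h_ab(m) • s)`. -/
@[ext]
structure CFB.Hom (X Y : CFB G S) where
  cocycleMap : CC.Hom X.toCC Y.toCC
  bundleMap : BundleMap X.bundle Y.bundle
  base_eq : bundleMap.base = cocycleMap.base
  local_form : ∀ a b, HasLocalForm G bundleMap (X.coord.triv b) (Y.coord.triv a)
    (cocycleMap.h a b)

theorem CoordStructure.mem_baseSet {X : FibreBundle S} (A : CoordStructure G X)
    (i : A.cocycle.ι) (m : X.base) : m ∈ (A.triv i).baseSet ↔ m ∈ A.cocycle.U i := by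
  rw [A.baseSet_triv]; rfl

theorem HasLocalForm.comp_apply {X Y Z : FibreBundle S} {k : BundleMap X Y} {l : BundleMap Y Z}
    {e : Bundle.Trivialization S X.proj} {e' : Bundle.Trivialization S Y.proj} {e'' : Bundle.Trivialization S Z.proj}
    {h : X.base → G} {h' : Y.base → G} (H : HasLocalForm G k e e' h)
    (H' : HasLocalForm G l e' e'' h') (m : X.base) (hm : m ∈ e.baseSet)
    (hm' : k.base m ∈ e'.baseSet) (hm'' : l.base (k.base m) ∈ e''.baseSet) (s : S) :
    e'' ((k.comp l).total (e.toOpenPartialHomeomorph.symm (m, s))) =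
      ((k.comp l).base m, (h' (k.base m) * h m) • s) := by
  have h1 := H m hm hm' s
  have hmem : k.total (e.toOpenPartialHomeomorph.symm (m, s)) ∈ e'.source := by
    rw [e'.mem_source, k.comm, e.proj_symm_apply' hm]; exact hm'
  have h2 : k.total (e.toOpenPartialHomeomorph.symm (m, s)) =
      e'.toOpenPartialHomeomorph.symm (k.base m, h m • s) := by
    rw [← h1]; exact (e'.toOpenPartialHomeomorph.left_inv hmem).symm
  change e'' (l.total (k.total _)) = _
  rw [h2, H' (k.base m) hm' hm'' (h m • s), mul_smul]
  rfl

namespace CFB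

/-- The identity map of a coordinate bundle. -/
def Hom.id (X : CFB G S) : Hom X X where
  cocycleMap := CC.Hom.id X.toCC
  bundleMap := BundleMap.id X.bundle
  base_eq := rfl
  local_form a b m hb ha s := X.coord.transition a b m ((X.coord.mem_baseSet a m).1 ha)
    ((X.coord.mem_baseSet b m).1 hb) s

variable [LieGroup 𝓘(ℝ, G.model) ∞ G]

/-- Composition of maps of coordinate bundles (in diagrammatic order). -/
def Hom.comp {X Y Z : CFB G S} (k : Hom X Y) (l : Hom Y Z) : Hom X Z where
  cocycleMap := k.cocycleMap.comp l.cocycleMap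
  bundleMap := k.bundleMap.comp l.bundleMap
  base_eq := by
    change (fun m => l.bundleMap.base (k.bundleMap.base m)) = fun m =>
      l.cocycleMap.base (k.cocycleMap.base m)
    rw [k.base_eq, l.base_eq]
    rfl
  local_form a c m hc ha s := by
    obtain ⟨b, hb⟩ := Y.coord.cocycle.cover (k.bundleMap.base m)
    have key := (k.local_form b c).comp_apply (l.local_form a b) m hc
      ((Y.coord.mem_baseSet b _).2 hb) ha s
    rw [key]
    have e1 := CC.compFun_eq k.cocycleMap l.cocycleMap a b c m
      ((X.coord.mem_baseSet c m).1 hc) (by rw [← k.base_eq]; exact hb)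
      (by rw [← k.base_eq, ← l.base_eq]; exact (Z.coord.mem_baseSet a _).1 ha)
    rw [← k.base_eq] at e1
    change _ = (_, CC.compFun k.cocycleMap l.cocycleMap a c m • s)
    rw [e1]

/-- The category of coordinate `(G, λ)`-bundles. -/
instance : Category (CFB G S) where
  Hom := Hom
  id := Hom.id
  comp := Hom.comp
  id_comp {X Y} k := Hom.ext (Category.id_comp (X := X.toCC) (Y := Y.toCC) k.cocycleMap) rfl
  comp_id {X Y} k := Hom.ext (Category.comp_id (X := X.toCC) (Y := Y.toCC) k.cocycleMap) rfl
  assoc {W X Y Z} k l n := Hom.ext (Category.assoc (W := W.toCC) (X := X.toCC) (Y := Y.toCC)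
    (Z := Z.toCC) k.cocycleMap l.cocycleMap n.cocycleMap) rfl

end CFB

variable (G S) in
/-- The forgetful functor from coordinate bundles to cocycles. -/
def CU [LieGroup 𝓘(ℝ, G.model) ∞ G] : CFB G S ⥤ CC G where
  obj X := X.toCC
  map k := CFB.Hom.cocycleMap k
  map_id _ := rfl
  map_comp _ _ := rfl

/-! ### Coordinate free bundles -/

/-- Two coordinate `(G, λ)`-bundle structures `(U_j, ψ_j)` and `(U'_i, ψ'_i)` on a fibre bundle are
strictly equivalent if there are smooth `t_ij : U_j ∩ U'_i → G` with
`ψ'_i ∘ ψ_j⁻¹ (m, s) = (m, t_ij(m) • s)`. -/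
def StrictlyEquivalent {X : FibreBundle S} (A B : CoordStructure G X) : Prop :=
  ∀ i j, ∃ t : X.base → G, SmoothOn t {m | m ∈ A.cocycle.U j ∧ m ∈ B.cocycle.U i} ∧
    ∀ m ∈ A.cocycle.U j, m ∈ B.cocycle.U i → ∀ s : S,
      B.triv i ((A.triv j).toOpenPartialHomeomorph.symm (m, s)) = (m, t m • s)

/-- The bundle map `k` has a smooth local form in `e` and `e'`. -/
def HasSmoothForm (G : SmoothMfd.{u}) [Group G] [MulAction G S] {X Y : FibreBundle S}
    (k : BundleMap X Y) (e : Bundle.Trivialization S X.proj) (e' : Bundle.Trivialization S Y.proj) : Prop :=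
  ∃ h : X.base → G, SmoothOn h {m | m ∈ e.baseSet ∧ k.base m ∈ e'.baseSet} ∧
    HasLocalForm G k e e' h

theorem strictlyEquivalent_iff {X : FibreBundle S} (A B : CoordStructure G X) :
    StrictlyEquivalent A B ↔
      ∀ i j, HasSmoothForm G (BundleMap.id X) (A.triv j) (B.triv i) := by
  refine forall_congr' fun i => forall_congr' fun j => exists_congr fun t => ?_
  simp only [HasLocalForm, BundleMap.id, CoordStructure.mem_baseSet]

theorem HasLocalForm.unique [FaithfulSMul G S] {X Y : FibreBundle S} {k : BundleMap X Y}
    {e : Bundle.Trivialization S X.proj} {e' : Bundle.Trivialization S Y.proj} {h h' : X.base → G}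
    (H : HasLocalForm G k e e' h) (H' : HasLocalForm G k e e' h') (m : X.base)
    (hm : m ∈ e.baseSet) (hm' : k.base m ∈ e'.baseSet) : h m = h' m := by
  refine FaithfulSMul.eq_of_smul_eq_smul (α := S) fun s => ?_
  have := (H m hm hm' s).symm.trans (H' m hm hm' s)
  exact (Prod.ext_iff.1 this).2

theorem strictlyEquivalent_refl {X : FibreBundle S} (A : CoordStructure G X) :
    StrictlyEquivalent A A := fun i j =>
  ⟨A.cocycle.g i j, by simpa only [and_comm] using A.cocycle.smooth_g i j,
    fun m hj hi s => A.transition i j m hi hj s⟩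

theorem CFB.Hom.hasSmoothForm {X Y : CFB G S} (f : CFB.Hom X Y) (a : Y.coord.cocycle.ι)
    (b : X.coord.cocycle.ι) :
    HasSmoothForm G f.bundleMap (X.coord.triv b) (Y.coord.triv a) := by
  refine ⟨f.cocycleMap.h a b, ?_, f.local_form a b⟩
  have := f.cocycleMap.smooth_h a b
  refine ContMDiffOn.mono this ?_
  rintro m ⟨hb, ha⟩
  refine ⟨(X.coord.mem_baseSet b m).1 hb, ?_⟩
  rw [← f.base_eq]
  exact (Y.coord.mem_baseSet a _).1 ha

open Classical in
/-- The group valued function of a smooth local form, normalised to `1` outside of its domain. -/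
def localFun {X Y : FibreBundle S} {k : BundleMap X Y} {e : Bundle.Trivialization S X.proj}
    {e' : Bundle.Trivialization S Y.proj} (H : HasSmoothForm G k e e') (m : X.base) : G :=
  if m ∈ e.baseSet ∧ k.base m ∈ e'.baseSet then H.choose m else 1

theorem hasLocalForm_localFun {X Y : FibreBundle S} {k : BundleMap X Y}
    {e : Bundle.Trivialization S X.proj} {e' : Bundle.Trivialization S Y.proj} (H : HasSmoothForm G k e e') :
    HasLocalForm G k e e' (localFun H) := by
  intro m hm hm' s
  rw [localFun, if_pos ⟨hm, hm'⟩]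
  exact H.choose_spec.2 m hm hm' s

theorem smoothOn_localFun {X Y : FibreBundle S} {k : BundleMap X Y}
    {e : Bundle.Trivialization S X.proj} {e' : Bundle.Trivialization S Y.proj} (H : HasSmoothForm G k e e') :
    SmoothOn (localFun H) {m | m ∈ e.baseSet ∧ k.base m ∈ e'.baseSet} :=
  ContMDiffOn.congr H.choose_spec.1 fun _ hm => if_pos hm

/-- For three trivialisations, the group valued functions are compatible with composition. -/
theorem localFun_mul [FaithfulSMul G S] {X Y Z : FibreBundle S} {k : BundleMap X Y} {l : BundleMap Y Z}
    {n : BundleMap X Z} (hn : n = k.comp l)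
    {e : Bundle.Trivialization S X.proj} {e' : Bundle.Trivialization S Y.proj} {e'' : Bundle.Trivialization S Z.proj}
    {h : X.base → G} {h' : Y.base → G} {h'' : X.base → G}
    (H : HasLocalForm G k e e' h) (H' : HasLocalForm G l e' e'' h')
    (H'' : HasLocalForm G n e e'' h'') (m : X.base) (hm : m ∈ e.baseSet)
    (hm' : k.base m ∈ e'.baseSet) (hm'' : l.base (k.base m) ∈ e''.baseSet) :
    h' (k.base m) * h m = h'' m := by
  subst hn
  refine FaithfulSMul.eq_of_smul_eq_smul (α := S) fun s => ?_
  have := (H.comp_apply H' m hm hm' hm'' s).symm.trans (H'' m hm hm'' s)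
  exact (Prod.ext_iff.1 this).2

section Lie

variable [LieGroup 𝓘(ℝ, G.model) ∞ G]

theorem HasSmoothForm.symm {X : FibreBundle S} {e e' : Bundle.Trivialization S X.proj}
    (H : HasSmoothForm G (BundleMap.id X) e e') : HasSmoothForm G (BundleMap.id X) e' e := by
  obtain ⟨h, hs, H⟩ := H
  refine ⟨fun m => (h m)⁻¹, ?_, ?_⟩
  · have : ContMDiffOn 𝓘(ℝ, X.base.model) 𝓘(ℝ, G.model) ∞ (fun m => (h m)⁻¹)
        {m | m ∈ e.baseSet ∧ m ∈ e'.baseSet} := ContMDiffOn.inv hs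
    exact this.mono fun m hm => ⟨hm.2, hm.1⟩
  · intro m hm' hm s
    have hm0 : m ∈ e.baseSet := hm
    have h1 : e' (e.toOpenPartialHomeomorph.symm (m, (h m)⁻¹ • s)) = (m, s) := by
      have := H m hm0 hm' ((h m)⁻¹ • s)
      rw [smul_inv_smul] at this
      exact this
    have hsrc : e.toOpenPartialHomeomorph.symm (m, (h m)⁻¹ • s) ∈ e'.source := by
      rw [e'.mem_source, e.proj_symm_apply' hm0]; exact hm'
    have h2 : e'.toOpenPartialHomeomorph.symm (m, s) =
        e.toOpenPartialHomeomorph.symm (m, (h m)⁻¹ • s) := by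
      rw [← h1]; exact e'.toOpenPartialHomeomorph.left_inv hsrc
    change e (e'.toOpenPartialHomeomorph.symm (m, s)) = (m, (h m)⁻¹ • s)
    rw [h2, e.apply_symm_apply' hm0]

variable [FaithfulSMul G S]

theorem HasSmoothForm.comp {X Y Z : FibreBundle S} {k : BundleMap X Y} {l : BundleMap Y Z}
    {e : Bundle.Trivialization S X.proj} {e'' : Bundle.Trivialization S Z.proj}
    (H : ∀ m ∈ e.baseSet, l.base (k.base m) ∈ e''.baseSet →
      ∃ e' : Bundle.Trivialization S Y.proj, k.base m ∈ e'.baseSet ∧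
        HasSmoothForm G k e e' ∧ HasSmoothForm G l e' e'') :
    HasSmoothForm G (k.comp l) e e'' := by
  classical
  have ex : ∀ m, ∃ g : G, (m ∈ e.baseSet ∧ l.base (k.base m) ∈ e''.baseSet) → ∀ s : S,
      e'' ((k.comp l).total (e.toOpenPartialHomeomorph.symm (m, s))) =
        ((k.comp l).base m, g • s) := by
    intro m
    by_cases hm : m ∈ e.baseSet ∧ l.base (k.base m) ∈ e''.baseSet
    · obtain ⟨e', he', ⟨h, -, H1⟩, ⟨h', -, H2⟩⟩ := H m hm.1 hm.2
      exact ⟨h' (k.base m) * h m, fun _ s => H1.comp_apply H2 m hm.1 he' hm.2 s⟩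
    · exact ⟨1, fun h => (hm h).elim⟩
  choose f hf using ex
  refine ⟨f, ?_, fun m hm hm' s => hf m ⟨hm, hm'⟩ s⟩
  rintro m ⟨hm, hm''⟩
  obtain ⟨e', he', ⟨h, hs, H1⟩, ⟨h', hs', H2⟩⟩ := H m hm hm''
  have hk : Continuous k.base := k.smooth_base.continuous
  have hl : Continuous l.base := l.smooth_base.continuous
  have hopen : IsOpen {x | x ∈ e.baseSet ∧ k.base x ∈ e'.baseSet ∧
      l.base (k.base x) ∈ e''.baseSet} :=
    e.open_baseSet.inter ((e'.open_baseSet.preimage hk).inter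
      (e''.open_baseSet.preimage (hl.comp hk)))
  have h1 : ContMDiffOn 𝓘(ℝ, X.base.model) 𝓘(ℝ, G.model) ∞
      (fun x => h' (k.base x) * h x) {x | x ∈ e.baseSet ∧ k.base x ∈ e'.baseSet ∧
        l.base (k.base x) ∈ e''.baseSet} := by
    apply ContMDiffOn.mul
    · exact ContMDiffOn.comp hs' k.smooth_base.contMDiffOn (fun x hx => ⟨hx.2.1, hx.2.2⟩)
    · exact ContMDiffOn.mono hs (fun x hx => ⟨hx.1, hx.2.1⟩)
  have heq : ∀ x ∈ {x | x ∈ e.baseSet ∧ k.base x ∈ e'.baseSet ∧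
      l.base (k.base x) ∈ e''.baseSet}, f x = h' (k.base x) * h x := by
    rintro x ⟨hx, hx', hx''⟩
    refine FaithfulSMul.eq_of_smul_eq_smul (α := S) fun s => ?_
    have := (hf x ⟨hx, hx''⟩ s).symm.trans (H1.comp_apply H2 x hx hx' hx'' s)
    exact (Prod.ext_iff.1 this).2
  exact ((h1.congr heq).contMDiffAt (hopen.mem_nhds ⟨hm, he', hm''⟩)).contMDiffWithinAt

variable (G) in
/-- Strict equivalence as an equivalence relation. -/
def strictSetoid (X : FibreBundle S) : Setoid (CoordStructure G X) where
  r := StrictlyEquivalent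
  iseqv :=
    { refl := strictlyEquivalent_refl
      symm := fun {A B} H => (strictlyEquivalent_iff B A).2 fun i j =>
        ((strictlyEquivalent_iff A B).1 H j i).symm
      trans := fun {A B C} H H' => (strictlyEquivalent_iff A C).2 fun i j =>
        HasSmoothForm.comp (k := BundleMap.id X) (l := BundleMap.id X) fun m _ _ => by
          obtain ⟨b, hb⟩ := B.cocycle.cover m
          exact ⟨B.triv b, (B.mem_baseSet b m).2 hb, (strictlyEquivalent_iff A B).1 H b j,
            (strictlyEquivalent_iff B C).1 H' i b⟩ }

variable (G S) in
/-- Objects of the category of `(G, λ)`-fibre bundles: fibre bundles with a strict equivalence class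
of coordinate `(G, λ)`-bundle structures. -/
structure FB where
  bundle : FibreBundle S
  cls : Quotient (strictSetoid G bundle)

/-- The coordinate bundles that represent a `(G, λ)`-fibre bundle. -/
def FB.Represents (X : FB G S) (A : CoordStructure G X.bundle) : Prop :=
  Quotient.mk (strictSetoid G X.bundle) A = X.cls

/-- Arrows of `(G, λ)`-fibre bundles. An equivalence class of arrows of coordinate bundles with the
same underlying map of fibre bundles is given by this map. -/
@[ext]
structure FB.Hom (X Y : FB G S) where
  bundleMap : BundleMap X.bundle Y.bundle
  exists_rep : ∃ (A : CoordStructure G X.bundle) (B : CoordStructure G Y.bundle)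
    (f : CFB.Hom ⟨X.bundle, A⟩ ⟨Y.bundle, B⟩),
    X.Represents A ∧ Y.Represents B ∧ f.bundleMap = bundleMap

theorem FB.hasSmoothForm_of_represents (X : FB G S) {A B : CoordStructure G X.bundle}
    (hA : X.Represents A) (hB : X.Represents B) (i : B.cocycle.ι) (j : A.cocycle.ι) :
    HasSmoothForm G (BundleMap.id X.bundle) (A.triv j) (B.triv i) :=
  (strictlyEquivalent_iff A B).1
    (@Quotient.exact _ (strictSetoid G X.bundle) A B (hA.trans hB.symm)) i j

/-- An arrow has a smooth local form with respect to all representatives. -/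
theorem FB.Hom.hasSmoothForm {X Y : FB G S} (k : FB.Hom X Y) {A : CoordStructure G X.bundle}
    {B : CoordStructure G Y.bundle} (hA : X.Represents A) (hB : Y.Represents B)
    (a : B.cocycle.ι) (b : A.cocycle.ι) :
    HasSmoothForm G k.bundleMap (A.triv b) (B.triv a) := by
  obtain ⟨A', B', f, hA', hB', hf⟩ := k.exists_rep
  rw [← hf]
  have h1 : ∀ c, HasSmoothForm G f.bundleMap (A.triv b) (B'.triv c) := fun c =>
    HasSmoothForm.comp (k := BundleMap.id X.bundle) (l := f.bundleMap) fun m _ _ => by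
      obtain ⟨d, hd⟩ := A'.cocycle.cover m
      exact ⟨A'.triv d, (A'.mem_baseSet d m).2 hd, X.hasSmoothForm_of_represents hA hA' d b,
        f.hasSmoothForm c d⟩
  exact HasSmoothForm.comp (k := f.bundleMap) (l := BundleMap.id Y.bundle) fun m _ _ => by
    obtain ⟨c, hc⟩ := B'.cocycle.cover (f.bundleMap.base m)
    exact ⟨B'.triv c, (B'.mem_baseSet c _).2 hc, h1 c, Y.hasSmoothForm_of_represents hB' hB a c⟩

/-- A map of fibre bundles with smooth local forms with respect to two coordinate structures lifts
to a map of coordinate bundles, by `(k m, h_ab(m) • s) = ψ'_a ∘ k ∘ ψ_b⁻¹ (m, s)`. -/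
def CFB.homOfSmoothForm {X Y : CFB G S} (k : BundleMap X.bundle Y.bundle)
    (H : ∀ a b, HasSmoothForm G k (X.coord.triv b) (Y.coord.triv a)) : CFB.Hom X Y where
  cocycleMap :=
    { base := k.base
      smooth_base := k.smooth_base
      h := fun a b => localFun (H a b)
      smooth_h := fun a b => by
        refine ContMDiffOn.mono (smoothOn_localFun (H a b)) ?_
        rintro m ⟨hb, ha⟩
        exact ⟨(X.coord.mem_baseSet b m).2 hb, (Y.coord.mem_baseSet a _).2 ha⟩
      h_off := fun a b m hm => if_neg fun h => hm
        ⟨(X.coord.mem_baseSet b m).1 h.1, (Y.coord.mem_baseSet a _).1 h.2⟩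
      h_mul_g := fun a b c m hc hb ha =>
        localFun_mul (k := BundleMap.id X.bundle) (l := k) (n := k) rfl
          (e := X.coord.triv c) (e' := X.coord.triv b) (e'' := Y.coord.triv a)
          (fun m hc hb s => X.coord.transition b c m ((X.coord.mem_baseSet b m).1 hb)
            ((X.coord.mem_baseSet c m).1 hc) s)
          (hasLocalForm_localFun (H a b)) (hasLocalForm_localFun (H a c)) m
          ((X.coord.mem_baseSet c m).2 hc) ((X.coord.mem_baseSet b m).2 hb)
          ((Y.coord.mem_baseSet a _).2 ha)
      g_mul_h := fun a b c m hc hb ha =>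
        localFun_mul (k := k) (l := BundleMap.id Y.bundle) (n := k) rfl
          (e := X.coord.triv c) (e' := Y.coord.triv b) (e'' := Y.coord.triv a)
          (hasLocalForm_localFun (H b c))
          (fun m hc hb s => Y.coord.transition a b m ((Y.coord.mem_baseSet a m).1 hb)
            ((Y.coord.mem_baseSet b m).1 hc) s)
          (hasLocalForm_localFun (H a c)) m
          ((X.coord.mem_baseSet c m).2 hc) ((Y.coord.mem_baseSet b _).2 hb)
          ((Y.coord.mem_baseSet a _).2 ha) }
  bundleMap := k
  base_eq := rfl
  local_form a b := hasLocalForm_localFun (H a b)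

/-- The category of `(G, λ)`-fibre bundles. -/
instance : Category (FB G S) where
  Hom := FB.Hom
  id X :=
    { bundleMap := BundleMap.id X.bundle
      exists_rep := by
        obtain ⟨A, hA⟩ := @Quotient.exists_rep _ (strictSetoid G X.bundle) X.cls
        exact ⟨A, A, CFB.Hom.id ⟨X.bundle, A⟩, hA, hA, rfl⟩ }
  comp {X Y Z} k l :=
    { bundleMap := k.bundleMap.comp l.bundleMap
      exists_rep := by
        obtain ⟨A, B, f, hA, hB, hf⟩ := k.exists_rep
        obtain ⟨C, hC⟩ := @Quotient.exists_rep _ (strictSetoid G Z.bundle) Z.cls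
        let f' : CFB.Hom (⟨Y.bundle, B⟩ : CFB G S) ⟨Z.bundle, C⟩ :=
          CFB.homOfSmoothForm l.bundleMap fun a b => l.hasSmoothForm hB hC a b
        refine ⟨A, C, f.comp f', hA, hC, ?_⟩
        rw [← hf]
        rfl }
  id_comp _ := rfl
  comp_id _ := rfl
  assoc _ _ _ := rfl

variable (G S) in
/-- The quotient functor from coordinate bundles to `(G, λ)`-fibre bundles. -/
def quotientFunctor : CFB G S ⥤ FB G S where
  obj X := ⟨X.bundle, Quotient.mk (strictSetoid G X.bundle) X.coord⟩
  map {X Y} k :=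
    { bundleMap := CFB.Hom.bundleMap k
      exists_rep := ⟨X.coord, Y.coord, k, rfl, rfl, rfl⟩ }
  map_id _ := rfl
  map_comp _ _ := rfl

/-- The trivialisations of the maximal atlas: all those that occur in some representative. -/
def FB.maxIndex (X : FB G S) : Type u :=
  {e : Bundle.Trivialization S X.bundle.proj //
    ∃ A : CoordStructure G X.bundle, X.Represents A ∧ ∃ i, A.triv i = e}

theorem FB.hasSmoothForm_maxIndex {X Y : FB G S} (k : FB.Hom X Y) (e' : Y.maxIndex)
    (e : X.maxIndex) : HasSmoothForm G k.bundleMap e.1 e'.1 := by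
  obtain ⟨e, A, hA, i, rfl⟩ := e
  obtain ⟨e', B, hB, j, rfl⟩ := e'
  exact k.hasSmoothForm hA hB j i

/-- The maximal coordinate structure of a `(G, λ)`-fibre bundle: the union of all its
representatives, with the transition functions that they determine. -/
def FB.maxCoord (X : FB G S) : CoordStructure G X.bundle where
  cocycle :=
    { ι := X.maxIndex
      U := fun e => ⟨e.1.baseSet, e.1.open_baseSet⟩
      cover := fun m => by
        obtain ⟨A, hA⟩ := @Quotient.exists_rep _ (strictSetoid G X.bundle) X.cls
        obtain ⟨i, hi⟩ := A.cocycle.cover m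
        exact ⟨⟨A.triv i, A, hA, i, rfl⟩, (A.mem_baseSet i m).2 hi⟩
      g := fun e e' => localFun (FB.hasSmoothForm_maxIndex (𝟙 X) e e')
      smooth_g := fun e e' =>
        ContMDiffOn.mono (smoothOn_localFun (FB.hasSmoothForm_maxIndex (𝟙 X) e e'))
          fun m hm => ⟨hm.2, hm.1⟩
      g_off := fun e e' m hm => if_neg fun h => hm ⟨h.2, h.1⟩
      g_mul := fun e e' e'' m he he' he'' =>
        localFun_mul (k := BundleMap.id X.bundle) (l := BundleMap.id X.bundle)
          (n := BundleMap.id X.bundle) rfl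
          (hasLocalForm_localFun (FB.hasSmoothForm_maxIndex (𝟙 X) e' e''))
          (hasLocalForm_localFun (FB.hasSmoothForm_maxIndex (𝟙 X) e e'))
          (hasLocalForm_localFun (FB.hasSmoothForm_maxIndex (𝟙 X) e e'')) m he'' he' he
      g_self := fun e m he => by
        have h : HasLocalForm G (BundleMap.id X.bundle) e.1 e.1 (fun _ => 1) := by
          intro m hm _ s
          change e.1 (e.1.toOpenPartialHomeomorph.symm (m, s)) = (m, (1 : G) • s)
          rw [e.1.apply_symm_apply' hm, one_smul]
        exact (hasLocalForm_localFun (FB.hasSmoothForm_maxIndex (𝟙 X) e e)).unique h m he he }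
  triv := fun e => e.1
  smooth_triv := fun e => by
    obtain ⟨e, A, hA, i, rfl⟩ := e
    exact A.smooth_triv i
  baseSet_triv := fun e => rfl
  transition := fun e e' m he he' s =>
    hasLocalForm_localFun (FB.hasSmoothForm_maxIndex (𝟙 X) e e') m he' he s

variable (G S) in
/-- The canonical section of the quotient functor: it sends a `(G, λ)`-fibre bundle to its maximal
coordinate structure, and an arrow to its unique lift. -/
def sectionFunctor : FB G S ⥤ CFB G S where
  obj X := ⟨X.bundle, X.maxCoord⟩
  map {X Y} k := CFB.homOfSmoothForm (X := ⟨X.bundle, X.maxCoord⟩) (Y := ⟨Y.bundle, Y.maxCoord⟩)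
    k.bundleMap fun a b => FB.hasSmoothForm_maxIndex k a b
  map_id X := by
    refine CFB.Hom.ext ?_ rfl
    exact CC.Hom.ext_of rfl fun a b m hb ha => rfl
  map_comp {X Y Z} k l := by
    refine CFB.Hom.ext ?_ rfl
    refine CC.Hom.ext_of rfl fun a c m hc ha => ?_
    obtain ⟨e, A, hA, i, rfl⟩ := c
    obtain ⟨B, hB⟩ := @Quotient.exists_rep _ (strictSetoid G Y.bundle) Y.cls
    obtain ⟨j, hj⟩ := B.cocycle.cover (k.bundleMap.base m)
    let b : Y.maxIndex := ⟨B.triv j, B, hB, j, rfl⟩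
    have hb : k.bundleMap.base m ∈ b.1.baseSet := (B.mem_baseSet j _).2 hj
    let c : X.maxIndex := ⟨A.triv i, A, hA, i, rfl⟩
    let K : CFB.Hom (⟨X.bundle, X.maxCoord⟩ : CFB G S) ⟨Y.bundle, Y.maxCoord⟩ :=
      CFB.homOfSmoothForm k.bundleMap fun a b => FB.hasSmoothForm_maxIndex k a b
    let L : CFB.Hom (⟨Y.bundle, Y.maxCoord⟩ : CFB G S) ⟨Z.bundle, Z.maxCoord⟩ :=
      CFB.homOfSmoothForm l.bundleMap fun a b => FB.hasSmoothForm_maxIndex l a b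
    refine Eq.symm ((CC.compFun_eq K.cocycleMap L.cocycleMap a b c m hc hb ha).trans ?_)
    exact localFun_mul (k := k.bundleMap) (l := l.bundleMap) rfl
      (hasLocalForm_localFun (FB.hasSmoothForm_maxIndex k b c))
      (hasLocalForm_localFun (FB.hasSmoothForm_maxIndex l a b))
      (hasLocalForm_localFun (FB.hasSmoothForm_maxIndex (k ≫ l) a c)) m hc hb ha

end Lie

end Coordinate

/-! ### The fibre bundle of a cocycle -/

section Construction

variable {G : SmoothMfd.{u}} [Group G] (S : SmoothMfd.{u})
  [MulAction G S] [ContMDiffSMul 𝓘(ℝ, G.model) 𝓘(ℝ, S.model) ∞ G S]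

theorem GCocycle.smooth_smul {M : SmoothMfd.{u}} (g : M → G) {s : Set M} (hg : SmoothOn g s) :
    ContMDiffOn (𝓘(ℝ, M.model).prod 𝓘(ℝ, S.model)) 𝓘(ℝ, S.model) ∞
      (fun p : M × S => g p.1 • p.2) {p | p.1 ∈ s} := by
  have h1 : ContMDiffOn (𝓘(ℝ, M.model).prod 𝓘(ℝ, S.model)) 𝓘(ℝ, G.model) ∞
      (fun p : M × S => g p.1) {p | p.1 ∈ s} :=
    ContMDiffOn.comp hg contMDiffOn_fst fun p hp => hp
  have h2 := h1.prodMk (contMDiffOn_snd (I := 𝓘(ℝ, M.model)) (J := 𝓘(ℝ, S.model)) (M := M)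
    (N := S) (n := ∞) (s := {p : M × S | p.1 ∈ s}))
  exact (ContMDiffSMul.contMDiff_smul (I := 𝓘(ℝ, G.model)) (I' := 𝓘(ℝ, S.model)) (n := ∞)
    (G := G) (M := S)).comp_contMDiffOn h2

/-- The space obtained by gluing the products `U i × S` along
`(j, m, s) ∼ (i, m, g_ij(m) • s)`. -/
def GCocycle.core {M : SmoothMfd.{u}} (C : GCocycle G M) : FiberBundleCore C.ι M S where
  baseSet i := C.U i
  isOpen_baseSet i := (C.U i).isOpen
  indexAt m := (C.cover m).choose
  mem_baseSet_at m := (C.cover m).choose_spec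
  coordChange j i m s := C.g i j m • s
  coordChange_self i m hm s := by rw [C.g_self i m hm, one_smul]
  continuousOn_coordChange j i := by
    refine ContinuousOn.mono
      (GCocycle.smooth_smul S (C.g i j) (C.smooth_g i j)).continuousOn fun p hp => ?_
    exact ⟨hp.1.2, hp.1.1⟩
  coordChange_comp i j k m hm s := by
    rw [← mul_smul, C.g_mul k j i m hm.2 hm.1.2 hm.1.1]

theorem GCocycle.core_transition {M : SmoothMfd.{u}} (C : GCocycle G M) (i j : C.ι) (m : M)
    (hi : m ∈ C.U i) (hj : m ∈ C.U j) (s : S) :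
    (C.core S).localTriv i (((C.core S).localTriv j).toOpenPartialHomeomorph.symm (m, s)) =
      (m, C.g i j m • s) := by
  have h := (C.cover m).choose_spec
  rw [FiberBundleCore.localTriv_symm_apply, FiberBundleCore.localTriv_apply]
  change (m, C.g i (C.cover m).choose m • C.g (C.cover m).choose j m • s) = _
  rw [← mul_smul, C.g_mul i _ j m hi h hj]

namespace CC

theorem smooth_transition (C : CC G) (i j : C.cocycle.ι) :
    ContMDiffOn (𝓘(ℝ, C.base.model).prod 𝓘(ℝ, S.model))
      (𝓘(ℝ, C.base.model).prod 𝓘(ℝ, S.model)) ∞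
      (fun p => (C.cocycle.core S).localTriv j
        (((C.cocycle.core S).localTriv i).toOpenPartialHomeomorph.symm p))
      {p | p.1 ∈ ((C.cocycle.core S).localTriv i).baseSet ∧
        p.1 ∈ ((C.cocycle.core S).localTriv j).baseSet} := by
  have h1 := GCocycle.smooth_smul S _ (C.cocycle.smooth_g j i)
  have h2 := (contMDiffOn_fst (I := 𝓘(ℝ, C.base.model)) (J := 𝓘(ℝ, S.model)) (M := C.base)
    (N := S) (n := ∞)).prodMk h1
  refine (h2.congr fun p hp => ?_).mono fun p hp => ⟨hp.2, hp.1⟩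
  exact C.cocycle.core_transition S j i p.1 hp.1 hp.2 p.2

/-- The total space of the fibre bundle of a cocycle. -/
def totalMfd (C : CC G) : SmoothMfd.{u} :=
  gluedMfd (M := C.base) (proj := (C.cocycle.core S).proj)
    (C.cocycle.core S).continuous_proj (C.cocycle.core S).localTriv
    (fun t => (C.cocycle.core S).indexAt t.1) (fun t => (C.cocycle.core S).mem_baseSet_at t.1)
    C.cocycle.cover (C.smooth_transition S)

/-- Its projection. -/
def totalProj (C : CC G) : C.totalMfd S → C.base := (C.cocycle.core S).proj

/-- Its local trivialisations. -/
def totalTriv (C : CC G) (i : C.cocycle.ι) : Bundle.Trivialization S (C.totalProj S) :=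
  (C.cocycle.core S).localTriv i

theorem isSmoothTriv_totalTriv (C : CC G) (i : C.cocycle.ι) : IsSmoothTriv (C.totalTriv S i) :=
  gluedMfd_isSmoothTriv (M := C.base) (proj := (C.cocycle.core S).proj)
    (C.cocycle.core S).continuous_proj (C.cocycle.core S).localTriv
    (fun t => (C.cocycle.core S).indexAt t.1) (fun t => (C.cocycle.core S).mem_baseSet_at t.1)
    C.cocycle.cover (C.smooth_transition S) i

theorem exists_totalTriv (C : CC G) (m : C.base) :
    ∃ e : Bundle.Trivialization S (C.totalProj S), m ∈ e.baseSet ∧ IsSmoothTriv e := by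
  obtain ⟨i, hi⟩ := C.cocycle.cover m
  exact ⟨C.totalTriv S i, hi, C.isSmoothTriv_totalTriv S i⟩

/-- The fibre bundle with fibre `S` of a cocycle. -/
def toFibreBundle (C : CC G) : FibreBundle S where
  total := C.totalMfd S
  base := C.base
  proj := C.totalProj S
  smooth_proj := smooth_proj_of_triv (C.exists_totalTriv S)
  exists_triv := C.exists_totalTriv S

/-- The coordinate bundle with fibre `S` of a cocycle. -/
def toCFB (C : CC G) : CFB G S where
  bundle := C.toFibreBundle S
  coord :=
    { cocycle := C.cocycle
      triv := C.totalTriv S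
      smooth_triv := C.isSmoothTriv_totalTriv S
      baseSet_triv := fun _ => rfl
      transition := fun i j m hi hj s => C.cocycle.core_transition S i j m hi hj s }

/-- The map of total spaces induced by a map of cocycles:
`[b, m, s] ↦ [a, k m, h_ab(m) • s]`. -/
def Hom.totalMap {C D : CC G} (k : Hom C D) (t : (C.cocycle.core S).TotalSpace) :
    (D.cocycle.core S).TotalSpace :=
  ⟨k.base t.1, @HSMul.hSMul G S S _
    (k.h (D.cocycle.cover (k.base t.1)).choose (C.cocycle.cover t.1).choose t.1) t.2⟩

theorem Hom.totalMap_local {C D : CC G} (k : Hom C D) (a : D.cocycle.ι) (b : C.cocycle.ι)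
    (m : C.base) (hb : m ∈ C.cocycle.U b) (ha : k.base m ∈ D.cocycle.U a) (s : S) :
    (D.cocycle.core S).localTriv a (k.totalMap S
      (((C.cocycle.core S).localTriv b).toOpenPartialHomeomorph.symm (m, s))) =
        (k.base m, k.h a b m • s) := by
  have h := (C.cocycle.cover m).choose_spec
  have h' := (D.cocycle.cover (k.base m)).choose_spec
  have key : ∀ a' b', m ∈ C.cocycle.U b' → k.base m ∈ D.cocycle.U a' →
      D.cocycle.g a a' (k.base m) • k.h a' b' m •
        C.cocycle.g b' b m • s = k.h a b m • s := fun a' b' h h' => by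
    rw [← mul_smul, ← mul_smul, mul_assoc, k.h_mul_g a' b' b m hb h h',
      k.g_mul_h a a' b m hb h' ha]
  exact congrArg (Prod.mk (k.base m)) (key _ _ h h')

theorem Hom.smooth_totalMap {C D : CC G} (k : Hom C D) :
    Smooth (M := C.totalMfd S) (N := D.totalMfd S) (k.totalMap S) := by
  intro t
  obtain ⟨b, hb⟩ := C.cocycle.cover (C.totalProj S t)
  obtain ⟨a, ha⟩ := D.cocycle.cover (k.base (C.totalProj S t))
  let e : Bundle.Trivialization S (C.totalProj S) := C.totalTriv S b
  let e' : Bundle.Trivialization S (D.totalProj S) := D.totalTriv S a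
  have he : IsSmoothTriv e := C.isSmoothTriv_totalTriv S b
  have he' : IsSmoothTriv e' := D.isSmoothTriv_totalTriv S a
  have ht : t ∈ e.source := e.mem_source.2 hb
  have het : (e t).1 = C.totalProj S t := e.coe_fst ht
  have h1 := (he.1 t ht).contMDiffAt (e.open_source.mem_nhds ht)
  have hopen : IsOpen {m | m ∈ C.cocycle.U b ∧ k.base m ∈ D.cocycle.U a} :=
    (C.cocycle.U b).isOpen.inter ((D.cocycle.U a).isOpen.preimage k.smooth_base.continuous)
  have hopen2 : IsOpen {p : C.base × S | p.1 ∈ {m | m ∈ C.cocycle.U b ∧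
      k.base m ∈ D.cocycle.U a}} := hopen.preimage continuous_fst
  have h2 : ContMDiffOn (𝓘(ℝ, C.base.model).prod 𝓘(ℝ, S.model)) _ ∞
      (fun p : C.base × S => (k.base p.1, k.h a b p.1 • p.2)) _ :=
    (ContMDiff.comp k.smooth_base contMDiff_fst).contMDiffOn.prodMk
      (GCocycle.smooth_smul S _ (k.smooth_h a b))
  have hmem : e t ∈ {p : C.base × S | p.1 ∈ {m | m ∈ C.cocycle.U b ∧
      k.base m ∈ D.cocycle.U a}} := by
    change (e t).1 ∈ C.cocycle.U b ∧ k.base (e t).1 ∈ D.cocycle.U a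
    rw [het]; exact ⟨hb, ha⟩
  have h3 := (h2 (e t) hmem).contMDiffAt (hopen2.mem_nhds hmem)
  have hmem' : (k.base (e t).1, k.h a b (e t).1 • (e t).2) ∈ e'.target :=
    e'.mem_target.2 hmem.2
  have h4 := (he'.2 _ hmem').contMDiffAt (e'.open_target.mem_nhds hmem')
  have h5 := ContMDiffAt.comp t h4 (ContMDiffAt.comp t h3 h1)
  refine h5.congr_of_eventuallyEq ?_
  have hV : IsOpen {z | C.totalProj S z ∈ {m | m ∈ C.cocycle.U b ∧
      k.base m ∈ D.cocycle.U a}} :=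
    hopen.preimage (C.toFibreBundle S).smooth_proj.continuous
  filter_upwards [hV.mem_nhds (x := t) ⟨hb, ha⟩] with z hz
  have hz' : z ∈ e.source := e.mem_source.2 hz.1
  have hez : (e z).1 = C.totalProj S z := e.coe_fst hz'
  have h6 := k.totalMap_local S a b (e z).1 (by rw [hez]; exact hz.1) (by rw [hez]; exact hz.2)
    (e z).2
  have h7 : e.toOpenPartialHomeomorph.symm ((e z).1, (e z).2) = z :=
    e.toOpenPartialHomeomorph.left_inv hz'
  change e' (k.totalMap S (e.toOpenPartialHomeomorph.symm ((e z).1, (e z).2))) = _ at h6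
  rw [h7] at h6
  have h8 : k.totalMap S z ∈ e'.source := e'.mem_source.2 hz.2
  exact (e'.toOpenPartialHomeomorph.left_inv h8).symm.trans
    (congrArg e'.toOpenPartialHomeomorph.symm h6)

/-- The map of coordinate bundles induced by a map of cocycles. -/
def Hom.toCFB {C D : CC G} (k : Hom C D) : CFB.Hom (C.toCFB S) (D.toCFB S) where
  cocycleMap := k
  bundleMap :=
    { total := k.totalMap S
      base := k.base
      smooth_total := k.smooth_totalMap S
      smooth_base := k.smooth_base
      comm := fun _ => rfl }
  base_eq := rfl
  local_form a b m hb ha s := k.totalMap_local S a b m hb ha s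

end CC

variable (G) in
/-- The functor that sends a cocycle to the coordinate bundle with fibre `S` glued from it. -/
def CB [LieGroup 𝓘(ℝ, G.model) ∞ G] : CC G ⥤ CFB G S where
  obj C := C.toCFB S
  map k := CC.Hom.toCFB S k
  map_id C := by
    refine CFB.Hom.ext rfl (BundleMap.ext (funext fun t => ?_) rfl)
    have key : ∀ (b : C.cocycle.ι) (m : C.base), m ∈ C.cocycle.U b → ∀ s : S,
        C.cocycle.g b b m • s = s := fun b m hb s => by rw [C.cocycle.g_self b m hb, one_smul]
    exact Bundle.TotalSpace.ext rfl
      (heq_of_eq (key _ t.1 (C.cocycle.cover t.1).choose_spec t.2))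
  map_comp {C D E} k l := by
    refine CFB.Hom.ext rfl (BundleMap.ext (funext fun t => ?_) rfl)
    have key : ∀ (a : E.cocycle.ι) (b : D.cocycle.ι) (c : C.cocycle.ι) (m : C.base),
        m ∈ C.cocycle.U c → k.base m ∈ D.cocycle.U b → l.base (k.base m) ∈ E.cocycle.U a →
          ∀ s : S, CC.compFun k l a c m • s = l.h a b (k.base m) • k.h b c m • s :=
      fun a b c m hc hb ha s => by rw [CC.compFun_eq k l a b c m hc hb ha, mul_smul]
    exact Bundle.TotalSpace.ext rfl
      (heq_of_eq (key _ _ _ t.1 (C.cocycle.cover t.1).choose_spec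
        (D.cocycle.cover (k.base t.1)).choose_spec
        (E.cocycle.cover (l.base (k.base t.1))).choose_spec t.2))

end Construction

section Transfer

variable (G : SmoothMfd.{u}) [Group G] [LieGroup 𝓘(ℝ, G.model) ∞ G]

/-- The functor `C^{λμ} = Q^μ ∘ CB^μ ∘ CU^λ ∘ Σ^λ`, for effective actions `λ` on `S` and `μ` on
`S'`: it replaces the fibre `S` by `S'` and keeps the transition functions of the maximal atlas. -/
def transferFunctor (S S' : SmoothMfd.{u}) [MulAction G S] [FaithfulSMul G S]
    [MulAction G S'] [ContMDiffSMul 𝓘(ℝ, G.model) 𝓘(ℝ, S'.model) ∞ G S'] [FaithfulSMul G S'] :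
    FB G S ⥤ FB G S' :=
  sectionFunctor G S ⋙ CU G S ⋙ CB G S' ⋙ quotientFunctor G S'

/-- The category of principal `G`-bundles: the `(G, L)`-fibre bundles for the action `L` of `G` on
itself by left multiplication. -/
abbrev PB := FB G G

end Transfer

end

/-! Changing the fibre passes through the category of cocycles, which does not mention the fibre.
Both constituents of the passage, coordinate bundles to cocycles and coordinate bundles to their
strict equivalence classes, are equivalences; the two transfer functors are composed of mutually
inverse pieces.

For cocycles: forgetting the bundle glued from a cocycle returns that cocycle on the nose, so only
full faithfulness of `CU` needs an argument. A map of cocycles prescribes the bundle map in every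
pair of trivialisations. These prescriptions agree because of the two identities relating `h` to the
transition functions (`CFB.triv_liftTotal`), and the resulting map is smooth because the action is
(`smooth_of_localForm`). It is the only possible one, since trivialisations are injective
(`CFB.Hom.ext_cocycleMap`). Effectiveness plays no role here.

For strict equivalence classes: the quotient functor is full because an arrow has smooth local forms
in all representatives, and faithful because, for an effective action, a bundle map determines its
group valued functions (`CFB.Hom.ext_bundleMap`). The maximal structure lies in the class it comes
from, so the section followed by the quotient is isomorphic to the identity.

In both cases the other composite is isomorphic to the identity for formal reasons: such an
isomorphism may be constructed after applying a fully faithful functor. -/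

noncomputable section

/-! ### Fibre coordinates, and smoothness in local trivialisations. -/

section Lifting

variable {G S : SmoothMfd.{u}} [Group G] [MulAction G S]

/-- Over the common domain of two trivialisations of a coordinate structure, the fibre coordinates
differ by the transition function. -/
theorem CoordStructure.triv_snd {X : FibreBundle S} (A : CoordStructure G X) (i j : A.cocycle.ι)
    (f : X.total) (hi : X.proj f ∈ A.cocycle.U i) (hj : X.proj f ∈ A.cocycle.U j) :
    (A.triv i f).2 = A.cocycle.g i j (X.proj f) • (A.triv j f).2 := by
  have hf : f ∈ (A.triv j).source := (A.triv j).mem_source.2 ((A.mem_baseSet j _).2 hj)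
  -- With this choice of fibre coordinate, the point to which the transition law applies is `ψ_j f`,
  -- and `ψ_j⁻¹` takes it back to `f`.
  have h := A.transition i j (X.proj f) hi hj (A.triv j f).2
  rw [← (A.triv j).coe_fst hf, Prod.mk.eta] at h
  erw [(A.triv j).toOpenPartialHomeomorph.left_inv hf] at h
  rw [h, (A.triv j).coe_fst hf]

/-- A map of total spaces over a smooth map of bases is smooth if locally, in smooth
trivialisations, it is given by a smooth group valued function. -/
theorem smooth_of_localForm [ContMDiffSMul 𝓘(ℝ, G.model) 𝓘(ℝ, S.model) ∞ G S]
    {X Y : FibreBundle S} (total : X.total → Y.total) (base : X.base → Y.base)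
    (smooth_base : Smooth base) (comm : ∀ f, Y.proj (total f) = base (X.proj f))
    (H : ∀ m, ∃ (e : Bundle.Trivialization S X.proj) (e' : Bundle.Trivialization S Y.proj)
      (h : X.base → G), IsSmoothTriv e ∧ IsSmoothTriv e' ∧ m ∈ e.baseSet ∧ base m ∈ e'.baseSet ∧
        SmoothOn h {m | m ∈ e.baseSet ∧ base m ∈ e'.baseSet} ∧
        ∀ m ∈ e.baseSet, base m ∈ e'.baseSet → ∀ s : S,
          e' (total (e.toOpenPartialHomeomorph.symm (m, s))) = (base m, h m • s)) :
    Smooth total := by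
  intro t
  obtain ⟨e, e', h, he, he', hb, ha, hs, hloc⟩ := H (X.proj t)
  have ht : t ∈ e.source := e.mem_source.2 hb
  have het : (e t).1 = X.proj t := e.coe_fst ht
  have h1 := (he.1 t ht).contMDiffAt (e.open_source.mem_nhds ht)
  have hopen : IsOpen {m | m ∈ e.baseSet ∧ base m ∈ e'.baseSet} :=
    e.open_baseSet.inter (e'.open_baseSet.preimage smooth_base.continuous)
  have hopen2 : IsOpen {p : X.base × S | p.1 ∈ {m | m ∈ e.baseSet ∧ base m ∈ e'.baseSet}} :=
    hopen.preimage continuous_fst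
  -- The map in coordinates; smoothness of the action enters here.
  have h2 : ContMDiffOn (𝓘(ℝ, X.base.model).prod 𝓘(ℝ, S.model)) _ ∞
      (fun p : X.base × S => (base p.1, h p.1 • p.2)) _ :=
    (ContMDiff.comp smooth_base contMDiff_fst).contMDiffOn.prodMk (GCocycle.smooth_smul S _ hs)
  have hmem : e t ∈ {p : X.base × S | p.1 ∈ {m | m ∈ e.baseSet ∧ base m ∈ e'.baseSet}} := by
    change (e t).1 ∈ e.baseSet ∧ base (e t).1 ∈ e'.baseSet
    rw [het]; exact ⟨hb, ha⟩
  have h3 := (h2 (e t) hmem).contMDiffAt (hopen2.mem_nhds hmem)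
  have hmem' : (base (e t).1, h (e t).1 • (e t).2) ∈ e'.target := e'.mem_target.2 hmem.2
  have h4 := (he'.2 _ hmem').contMDiffAt (e'.open_target.mem_nhds hmem')
  -- This composite, `e` followed by the coordinate map and the inverse of `e'`, agrees with `total`
  -- only where both trivialisations are defined, which is an open neighbourhood of `t`.
  have h5 := ContMDiffAt.comp t h4 (ContMDiffAt.comp t h3 h1)
  refine h5.congr_of_eventuallyEq ?_
  filter_upwards [(hopen.preimage X.smooth_proj.continuous).mem_nhds (x := t) ⟨hb, ha⟩] with z hz
  have hz' : z ∈ e.source := e.mem_source.2 hz.1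
  have hez : (e z).1 = X.proj z := e.coe_fst hz'
  have h6 := hloc (e z).1 (by rw [hez]; exact hz.1) (by rw [hez]; exact hz.2) (e z).2
  have h7 : e.toOpenPartialHomeomorph.symm ((e z).1, (e z).2) = z :=
    e.toOpenPartialHomeomorph.left_inv hz'
  rw [h7] at h6
  -- Covering `base` is what places `total z` in the domain of `e'`, so that the equation in
  -- coordinates can be inverted.
  have h8 : total z ∈ e'.source := e'.mem_source.2 (by rw [comm]; exact hz.2)
  exact (e'.toOpenPartialHomeomorph.left_inv h8).symm.trans
    (congrArg e'.toOpenPartialHomeomorph.symm h6)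

/-! ### Bundle maps from maps of cocycles. -/

/-- The map of total spaces of coordinate bundles determined by a map of their cocycles. -/
def CFB.liftTotal {X Y : CFB G S} (k : CC.Hom X.toCC Y.toCC) (f : X.bundle.total) :
    Y.bundle.total :=
  (Y.coord.triv (Y.coord.cocycle.cover (k.base (X.bundle.proj f))).choose).toOpenPartialHomeomorph.symm
    (k.base (X.bundle.proj f),
      k.h (Y.coord.cocycle.cover (k.base (X.bundle.proj f))).choose
        (X.coord.cocycle.cover (X.bundle.proj f)).choose (X.bundle.proj f) •
          (X.coord.triv (X.coord.cocycle.cover (X.bundle.proj f)).choose f).2)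

theorem CFB.proj_liftTotal {X Y : CFB G S} (k : CC.Hom X.toCC Y.toCC) (f : X.bundle.total) :
    Y.bundle.proj (CFB.liftTotal k f) = k.base (X.bundle.proj f) :=
  (Y.coord.triv _).proj_symm_apply' ((Y.coord.mem_baseSet _ _).2
    (Y.coord.cocycle.cover (k.base (X.bundle.proj f))).choose_spec)

/-- The indices `a'`, `b'` chosen in `CFB.liftTotal` do not matter. Passing from them to `a`, `b`
puts `g'_aa'` to the left and `g_b'b` to the right of `h_a'b'`, and the two identities for maps of
cocycles collapse `g'_aa' h_a'b' g_b'b` to `h_ab`. -/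
theorem CFB.triv_liftTotal {X Y : CFB G S} (k : CC.Hom X.toCC Y.toCC) (f : X.bundle.total)
    (a : Y.coord.cocycle.ι) (b : X.coord.cocycle.ι) (hb : X.bundle.proj f ∈ X.coord.cocycle.U b)
    (ha : k.base (X.bundle.proj f) ∈ Y.coord.cocycle.U a) :
    Y.coord.triv a (CFB.liftTotal k f) =
      (k.base (X.bundle.proj f), k.h a b (X.bundle.proj f) • (X.coord.triv b f).2) := by
  have ha' := (Y.coord.cocycle.cover (k.base (X.bundle.proj f))).choose_spec
  have hb' := (X.coord.cocycle.cover (X.bundle.proj f)).choose_spec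
  rw [CFB.liftTotal, Y.coord.transition a _ _ ha ha', X.coord.triv_snd _ b f hb' hb, ← mul_smul,
    ← mul_smul]
  have h1 := k.h_mul_g (Y.coord.cocycle.cover (k.base (X.bundle.proj f))).choose
    (X.coord.cocycle.cover (X.bundle.proj f)).choose b _ hb hb' ha'
  have h2 := k.g_mul_h a (Y.coord.cocycle.cover (k.base (X.bundle.proj f))).choose b _ hb ha' ha
  rw [← h2, ← h1, mul_assoc]
  rfl

/-- This is `CFB.triv_liftTotal` at the point with coordinates `(m, s)` in `ψ_b`, in the form that
`HasLocalForm` requires. -/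
theorem CFB.liftTotal_local {X Y : CFB G S} (k : CC.Hom X.toCC Y.toCC) (a : Y.coord.cocycle.ι)
    (b : X.coord.cocycle.ι) (m : X.bundle.base) (hb : m ∈ (X.coord.triv b).baseSet)
    (ha : k.base m ∈ (Y.coord.triv a).baseSet) (s : S) :
    Y.coord.triv a (CFB.liftTotal k ((X.coord.triv b).toOpenPartialHomeomorph.symm (m, s))) =
      (k.base m, k.h a b m • s) := by
  have hp : X.bundle.proj ((X.coord.triv b).toOpenPartialHomeomorph.symm (m, s)) = m :=
    (X.coord.triv b).proj_symm_apply' hb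
  have h := CFB.triv_liftTotal k ((X.coord.triv b).toOpenPartialHomeomorph.symm (m, s)) a b
    (by rw [hp]; exact (X.coord.mem_baseSet b m).1 hb)
    (by rw [hp]; exact (Y.coord.mem_baseSet a _).1 ha)
  rw [hp, (X.coord.triv b).apply_symm_apply' hb] at h
  exact h

/-- The map of coordinate bundles determined by a map of their cocycles. -/
def CFB.lift [ContMDiffSMul 𝓘(ℝ, G.model) 𝓘(ℝ, S.model) ∞ G S] {X Y : CFB G S}
    (k : CC.Hom X.toCC Y.toCC) : CFB.Hom X Y where
  cocycleMap := k
  bundleMap :=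
    { total := CFB.liftTotal k
      base := k.base
      smooth_total := by
        refine smooth_of_localForm (G := G) _ k.base k.smooth_base (CFB.proj_liftTotal k)
          fun m => ?_
        obtain ⟨b, hb⟩ := X.coord.cocycle.cover m
        obtain ⟨a, ha⟩ := Y.coord.cocycle.cover (k.base m)
        refine ⟨X.coord.triv b, Y.coord.triv a, k.h a b, X.coord.smooth_triv b,
          Y.coord.smooth_triv a, (X.coord.mem_baseSet b m).2 hb, (Y.coord.mem_baseSet a _).2 ha,
          ?_, fun m hb ha s => CFB.liftTotal_local k a b m hb ha s⟩
        exact ContMDiffOn.mono (k.smooth_h a b) fun m hm =>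
          ⟨(X.coord.mem_baseSet b m).1 hm.1, (Y.coord.mem_baseSet a _).1 hm.2⟩
      smooth_base := k.smooth_base
      comm := CFB.proj_liftTotal k }
  base_eq := rfl
  local_form a b m hb ha s := CFB.liftTotal_local k a b m hb ha s

/-! ### Uniqueness of maps of coordinate bundles. -/

/-- A map of coordinate bundles is determined by the map of cocycles. -/
theorem CFB.Hom.ext_cocycleMap {X Y : CFB G S} {k l : CFB.Hom X Y}
    (h : k.cocycleMap = l.cocycleMap) : k = l := by
  have hbase : k.bundleMap.base = l.bundleMap.base := by rw [k.base_eq, l.base_eq, h]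
  refine CFB.Hom.ext h (BundleMap.ext (funext fun f => ?_) hbase)
  obtain ⟨b, hb⟩ := X.coord.cocycle.cover (X.bundle.proj f)
  obtain ⟨a, ha⟩ := Y.coord.cocycle.cover (k.bundleMap.base (X.bundle.proj f))
  have hb' := (X.coord.mem_baseSet b _).2 hb
  have ha' := (Y.coord.mem_baseSet a _).2 ha
  have hf := (X.coord.triv b).mem_source.2 hb'
  have hsymm : (X.coord.triv b).toOpenPartialHomeomorph.symm
      (X.bundle.proj f, (X.coord.triv b f).2) = f := by
    rw [← (X.coord.triv b).coe_fst hf]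
    exact (X.coord.triv b).toOpenPartialHomeomorph.left_inv hf
  have hk := k.local_form a b _ hb' ha' (X.coord.triv b f).2
  have hl := l.local_form a b _ hb' (hbase ▸ ha') (X.coord.triv b f).2
  rw [hsymm] at hk hl
  -- Both images of `f` lie over the same point of the base set of `ψ'_a`, where `ψ'_a` is
  -- injective; their coordinates there are given by the same group valued function.
  refine (Y.coord.triv a).injOn ((Y.coord.triv a).mem_source.2 ?_)
    ((Y.coord.triv a).mem_source.2 ?_) ?_
  · rw [k.bundleMap.comm]; exact ha'
  · rw [l.bundleMap.comm, ← hbase]; exact ha'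
  · exact hk.trans (by rw [h, hbase]; exact hl.symm)

/-- For an effective action, a map of coordinate bundles is determined by the bundle map. -/
theorem CFB.Hom.ext_bundleMap [FaithfulSMul G S] {X Y : CFB G S} {k l : CFB.Hom X Y}
    (h : k.bundleMap = l.bundleMap) : k = l := by
  -- Only values on the common domains have to be compared, as all group valued functions are
  -- normalised to `1` elsewhere. There effectiveness determines them.
  refine CFB.Hom.ext (CC.Hom.ext_of (by rw [← k.base_eq, ← l.base_eq, h])
    fun a b m hb ha => ?_) h
  exact (k.local_form a b).unique (h ▸ l.local_form a b) m ((X.coord.mem_baseSet b m).2 hb)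
    ((Y.coord.mem_baseSet a _).2 (by rw [k.base_eq]; exact ha))

end Lifting

/-! ### Coordinate bundles and cocycles. -/

section Equivalences

variable (G S S' : SmoothMfd.{u}) [Group G] [LieGroup 𝓘(ℝ, G.model) ∞ G]
  [MulAction G S] [MulAction G S']

/-- The forgetful functor from coordinate bundles to cocycles is fully faithful. -/
def fullyFaithfulCU [ContMDiffSMul 𝓘(ℝ, G.model) 𝓘(ℝ, S.model) ∞ G S] :
    (CU G S).FullyFaithful where
  preimage k := CFB.lift k
  -- The lift carries the given cocycle map as a component.
  map_preimage _ := rfl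
  preimage_map _ := CFB.Hom.ext_cocycleMap rfl

/-- The cocycle of the coordinate bundle glued from a cocycle is the given one. -/
def cbCompCU [ContMDiffSMul 𝓘(ℝ, G.model) 𝓘(ℝ, S.model) ∞ G S] :
    CB G S ⋙ CU G S ≅ 𝟭 (CC G) :=
  -- Gluing keeps the cover and the transition functions unchanged.
  Iso.refl _

/-- Every coordinate bundle is naturally isomorphic to the one glued from its cocycle. -/
def cuCompCB [ContMDiffSMul 𝓘(ℝ, G.model) 𝓘(ℝ, S.model) ∞ G S] :
    CU G S ⋙ CB G S ≅ 𝟭 (CFB G S) :=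
  -- Composition with the fully faithful `CU` is fully faithful on functor categories, so it
  -- suffices to compare the two functors after applying `CU`. There the inner `CB G S ⋙ CU G S`
  -- cancels.
  (fullyFaithfulCU G S).whiskeringRight _ |>.preimageIso <|
    Functor.associator _ _ _ ≪≫ Functor.isoWhiskerLeft (CU G S) (cbCompCU G S) ≪≫
      Functor.rightUnitor _ ≪≫ (Functor.leftUnitor _).symm

/-! ### Coordinate bundles and strict equivalence classes. -/

variable [FaithfulSMul G S] [FaithfulSMul G S']

/-- The quotient functor from coordinate bundles to `(G, λ)`-fibre bundles is fully faithful. -/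
def fullyFaithfulQuotient : (quotientFunctor G S).FullyFaithful where
  preimage k := CFB.homOfSmoothForm (FB.Hom.bundleMap k)
    -- The two `rfl` say that a coordinate structure represents its own class.
    fun a b => FB.Hom.hasSmoothForm k rfl rfl a b
  map_preimage _ := rfl
  preimage_map _ := CFB.Hom.ext_bundleMap rfl

variable {G S} in
/-- The maximal coordinate structure represents the given strict equivalence class. -/
theorem FB.represents_maxCoord (X : FB G S) : X.Represents X.maxCoord := by
  obtain ⟨A, hA⟩ := @Quotient.exists_rep _ (strictSetoid G X.bundle) X.cls
  refine Eq.trans (@Quotient.sound _ (strictSetoid G X.bundle) _ _ ?_) hA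
  refine (strictlyEquivalent_iff X.maxCoord A).2 fun i j => ?_
  -- The trivialisations of the representative `A` belong to the maximal atlas, whose members are
  -- mutually compatible.
  exact FB.hasSmoothForm_maxIndex (𝟙 X) ⟨A.triv i, A, hA, i, rfl⟩ j

/-- A `(G, λ)`-fibre bundle is represented by its maximal coordinate structure. -/
def sectionCompQuotient : sectionFunctor G S ⋙ quotientFunctor G S ≅ 𝟭 (FB G S) :=
  -- Source and target have the same bundle, and the maximal structure represents the class of each.
  -- Hence the identity map of the bundle is an arrow both ways, and it is natural because arrows
  -- are determined by their bundle maps.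
  NatIso.ofComponents (fun X =>
    { hom :=
        { bundleMap := BundleMap.id X.bundle
          exists_rep := ⟨X.maxCoord, X.maxCoord, CFB.Hom.id ⟨X.bundle, X.maxCoord⟩, rfl,
            X.represents_maxCoord, rfl⟩ }
      inv :=
        { bundleMap := BundleMap.id X.bundle
          exists_rep := ⟨X.maxCoord, X.maxCoord, CFB.Hom.id ⟨X.bundle, X.maxCoord⟩,
            X.represents_maxCoord, rfl, rfl⟩ }
      hom_inv_id := rfl
      inv_hom_id := rfl }) fun _ => rfl

/-- A coordinate bundle is naturally isomorphic to its maximal extension. -/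
def quotientCompSection : quotientFunctor G S ⋙ sectionFunctor G S ≅ 𝟭 (CFB G S) :=
  -- The formal argument of `cuCompCB`, with the quotient functor as the fully faithful one.
  (fullyFaithfulQuotient G S).whiskeringRight _ |>.preimageIso <|
    Functor.associator _ _ _ ≪≫
      Functor.isoWhiskerLeft (quotientFunctor G S) (sectionCompQuotient G S) ≪≫
      Functor.rightUnitor _ ≪≫ (Functor.leftUnitor _).symm

/-! ### Change of fibre. -/

/-- Replacing the fibre `S` by `S'` and then `S'` by `S` gives back the original bundle. -/
def transferCompTransfer [ContMDiffSMul 𝓘(ℝ, G.model) 𝓘(ℝ, S.model) ∞ G S]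
    [ContMDiffSMul 𝓘(ℝ, G.model) 𝓘(ℝ, S'.model) ∞ G S'] :
    transferFunctor G S S' ⋙ transferFunctor G S' S ≅ 𝟭 (FB G S) :=
  -- Four adjacent pairs cancel, from the inside out: quotient and section for `S'`, then gluing and
  -- forgetting for `S'`, then forgetting and gluing for `S`, finally section and quotient for `S`.
  -- The `Iso.refl` steps only change brackets or drop identities.
  calc
    transferFunctor G S S' ⋙ transferFunctor G S' S
    _ ≅ sectionFunctor G S ⋙ CU G S ⋙ CB G S' ⋙
        (quotientFunctor G S' ⋙ sectionFunctor G S') ⋙ CU G S' ⋙ CB G S ⋙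
          quotientFunctor G S := Iso.refl _
    _ ≅ sectionFunctor G S ⋙ CU G S ⋙ CB G S' ⋙ 𝟭 _ ⋙ CU G S' ⋙ CB G S ⋙
          quotientFunctor G S :=
      Functor.isoWhiskerLeft _ <| Functor.isoWhiskerLeft _ <| Functor.isoWhiskerLeft _ <|
        Functor.isoWhiskerRight (quotientCompSection G S') _
    _ ≅ sectionFunctor G S ⋙ CU G S ⋙ (CB G S' ⋙ CU G S') ⋙ CB G S ⋙
          quotientFunctor G S := Iso.refl _
    _ ≅ sectionFunctor G S ⋙ CU G S ⋙ 𝟭 _ ⋙ CB G S ⋙ quotientFunctor G S :=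
      Functor.isoWhiskerLeft _ <| Functor.isoWhiskerLeft _ <|
        Functor.isoWhiskerRight (cbCompCU G S') _
    _ ≅ sectionFunctor G S ⋙ (CU G S ⋙ CB G S) ⋙ quotientFunctor G S := Iso.refl _
    _ ≅ sectionFunctor G S ⋙ 𝟭 _ ⋙ quotientFunctor G S :=
      Functor.isoWhiskerLeft _ <| Functor.isoWhiskerRight (cuCompCB G S) _
    _ ≅ sectionFunctor G S ⋙ quotientFunctor G S := Iso.refl _
    _ ≅ 𝟭 (FB G S) := sectionCompQuotient G S

/-- The transfer functors are mutually inverse equivalences. -/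
def transferEquivalence [ContMDiffSMul 𝓘(ℝ, G.model) 𝓘(ℝ, S.model) ∞ G S]
    [ContMDiffSMul 𝓘(ℝ, G.model) 𝓘(ℝ, S'.model) ∞ G S'] : FB G S' ≌ FB G S :=
  -- The unit is adjusted to satisfy the triangle identity; the two functors stay as given.
  CategoryTheory.Equivalence.mk (transferFunctor G S' S) (transferFunctor G S S')
    (transferCompTransfer G S' S).symm (transferCompTransfer G S S')

end Equivalences

end

theorem theorem2 (G S S' : SmoothMfd.{u}) [Group G] [LieGroup 𝓘(ℝ, G.model) ∞ G]
    [MulAction G S] [ContMDiffSMul 𝓘(ℝ, G.model) 𝓘(ℝ, S.model) ∞ G S] [FaithfulSMul G S]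
    [MulAction G S'] [ContMDiffSMul 𝓘(ℝ, G.model) 𝓘(ℝ, S'.model) ∞ G S'] [FaithfulSMul G S'] :
    (∃ E : FB G S' ≌ FB G S,
      E.functor = transferFunctor G S' S ∧ E.inverse = transferFunctor G S S') ∧
    (∃ E : PB G ≌ FB G S,
      E.functor = transferFunctor G G S ∧ E.inverse = transferFunctor G S G) :=
  -- The principal case is `S' = G`, as left multiplication is smooth and effective.
  ⟨⟨transferEquivalence G S S', rfl, rfl⟩, ⟨transferEquivalence G S G, rfl, rfl⟩⟩
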